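/- **Definitions.** A lattice simplex $\Delta\subset\mathbb R^d$ is the convex hull of $d+1$ affinely independent points $p_0,\dots,p_d\in\mathbb Z^d$; put $$\Lambda_\Delta=\Bigl\{(x_0,\dots,x_d)\in(\mathbb R/\mathbb Z)^{d+1}:\ \sum_{i=0}^d x_i\,(p_i,1)\in\mathbb Z^{d+1}\Bigr\}.$$ The $\delta$-polynomial of a $d$-dimensional lattice polytope $P\subset\mathbb R^d$ is $\delta(P,t)=(1-t)^{d+1}\bigl(1+\sum_{n\ge1}|nP\cap\mathbb Z^d|\,t^n\bigr)$. Two subsets $P,Q$ of $\mathbb R^d$ are unimodularly equivalent if $Q=PU+w$ for some $U\in\mathbb Z^{d\times d}$ with $\det U=\pm1$ and some $w\in\mathbb Z^d$. A lattice polytope $P\subset\mathbb R^d$ is reflexive if $0$ lies in its interior and $\{y:\langle x,y\rangle\le1\ \forall x\in P\}$ is a lattice polytope; it is Gorenstein if $rP$ is unimodularly equivalent to a reflexive polytope for some integer $r\ge1$. For integers $v\ge2$ and $k\ge0$ let $M(v,k)$ be the number, up to unimodular equivalence (over all dimensions $d$), of Gorenstein simplices $\Delta\subset\mathbb R^d$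 of dimension $d$ with $$\delta(\Delta,t)=1+t^{k+1}+t^{2(k+1)}+\cdots+t^{(v-1)(k+1)}$$ such that, for some ordering of the vertices, $\Lambda_\Delta$ is generated by a single element of the form $$\bigl(\underbrace{1/v_1,\dots,1/v_1}_{s_1},\underbrace{1/v_2,\dots,1/v_2}_{s_2},\dots,\underbrace{1/v_t,\dots,1/v_t}_{s_t}\bigr)\in(\mathbb R/\mathbb Z)^{d+1},$$ where $t\ge1$, $1<v_1<\cdots<v_t=v$ are integers with $v_i\mid v_{i+1}$ for $1\le i\le t-1$, and $s_1,\dots,s_t$ are positive integers. By convention, $M(1,k)=1$. For a positive integer $v$ let $D_v$ be the set of divisors of $v$ ordered by divisibility; a chain in $D_v$ is a totally ordered subset. **Corollary.** Let $v\ge2$ and $k\ge0$ be integers. Then $M(v,k)$ equals the number of chains in $D_v$ whose smallest element is not the least element $1$ of $D_v$ and whose largest element is $v$. Moreover, $$M(v,k)=\sum_{n\in D_v\setminus\{v\}}M(n,k).$$ -/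

import Mathlib

open scoped Pointwise

/-- An integer vector regarded as a point of `ℝ^d`. -/
def latticePoint {d : ℕ} (z : Fin d → ℤ) : Fin d → ℝ := fun i => (z i : ℝ)

/-- A lattice polytope in `ℝ^d`: the convex hull of finitely many integer points. -/
def IsLatticePolytope {d : ℕ} (P : Set (Fin d → ℝ)) : Prop :=
  ∃ V : Finset (Fin d → ℤ), P = convexHull ℝ (latticePoint '' (V : Set (Fin d → ℤ)))

/-- `P` is a `d`-dimensional lattice simplex in `ℝ^d` and `p 0, …, p d` is an ordering of its
vertices. -/
def IsVertexOrdering {d : ℕ} (P : Set (Fin d → ℝ)) (p : Fin (d + 1) → Fin d → ℤ) : Prop :=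
  AffineIndependent ℝ (fun i => latticePoint (p i)) ∧
    P = convexHull ℝ (Set.range fun i => latticePoint (p i))

/-- The finite abelian group `Λ_Δ ⊆ (ℝ/ℤ)^(d+1)` of the lattice simplex with (ordered) vertices
`p 0, …, p d`: all `(x_0, …, x_d)` such that `∑ x_i (p_i, 1)` lies in `ℤ^(d+1)`, i.e. such that
each of the `d + 1` coordinates of this sum vanishes in `ℝ/ℤ`. -/
def simplexGroup {d : ℕ} (p : Fin (d + 1) → Fin d → ℤ) :
    AddSubgroup (Fin (d + 1) → AddCircle (1 : ℝ)) where
  carrier := {x | (∀ j, ∑ i, p i j • x i = 0) ∧ ∑ i, x i = 0}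
  zero_mem' := by simp
  add_mem' := by
    rintro x y ⟨hx, hx'⟩ ⟨hy, hy'⟩
    refine ⟨fun j => ?_, ?_⟩
    · simp [Finset.sum_add_distrib, hx j, hy j]
    · simp [Finset.sum_add_distrib, hx', hy']
  neg_mem' := by
    rintro x ⟨hx, hx'⟩
    refine ⟨fun j => ?_, ?_⟩
    · simp [hx j]
    · simp [hx']

/-- The affine map `x ↦ x U + w` of `ℝ^d`. -/
def latticeAffineMap {d : ℕ} (U : Matrix (Fin d) (Fin d) ℤ) (w : Fin d → ℤ)
    (x : Fin d → ℝ) : Fin d → ℝ :=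
  Matrix.vecMul x (U.map (Int.castRingHom ℝ)) + latticePoint w

/-- Unimodular equivalence: `Q = P U + w` with an integer matrix `U` of determinant `±1` and an
integer vector `w`. -/
def UnimodularlyEquivalent {d : ℕ} (P Q : Set (Fin d → ℝ)) : Prop :=
  ∃ (U : Matrix (Fin d) (Fin d) ℤ) (w : Fin d → ℤ),
    (U.det = 1 ∨ U.det = -1) ∧ Q = latticeAffineMap U w '' P

theorem latticePoint_vecMul {d : ℕ} (U : Matrix (Fin d) (Fin d) ℤ) (w : Fin d → ℤ) :
    Matrix.vecMul (latticePoint w) (U.map (Int.castRingHom ℝ)) =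
      latticePoint (Matrix.vecMul w U) := by
  ext j
  simp [latticePoint, Matrix.vecMul, dotProduct]

theorem latticeAffineMap_comp {d : ℕ} (U V : Matrix (Fin d) (Fin d) ℤ) (w z : Fin d → ℤ)
    (x : Fin d → ℝ) :
    latticeAffineMap V z (latticeAffineMap U w x) =
      latticeAffineMap (U * V) (Matrix.vecMul w V + z) x := by
  unfold latticeAffineMap
  rw [Matrix.add_vecMul, Matrix.vecMul_vecMul, latticePoint_vecMul, Matrix.map_mul, add_assoc]
  congr 1
  ext j
  simp [latticePoint]

theorem latticeAffineMap_one_zero {d : ℕ} (x : Fin d → ℝ) : latticeAffineMap 1 0 x = x := by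
  ext j
  simp [latticeAffineMap, latticePoint]

theorem unimodularlyEquivalent_equivalence (d : ℕ) :
    Equivalence (UnimodularlyEquivalent (d := d)) where
  refl P := ⟨1, 0, by simp, by simp [latticeAffineMap_one_zero]⟩
  symm := by
    rintro P Q ⟨U, w, hU, rfl⟩
    have hunit : IsUnit U.det := by rcases hU with h | h <;> simp [h]
    refine ⟨U⁻¹, -Matrix.vecMul w U⁻¹, ?_, ?_⟩
    · have h1 : U.det * U⁻¹.det = 1 := by
        rw [← Matrix.det_mul, Matrix.mul_nonsing_inv U hunit, Matrix.det_one]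
      rcases hU with h | h
      · left
        rw [h] at h1
        linarith
      · right
        rw [h] at h1
        linarith
    · rw [Set.image_image]
      simp [latticeAffineMap_comp, Matrix.mul_nonsing_inv U hunit, latticeAffineMap_one_zero]
  trans := by
    rintro P Q R ⟨U, w, hU, rfl⟩ ⟨V, z, hV, rfl⟩
    refine ⟨U * V, Matrix.vecMul w V + z, ?_, ?_⟩
    · rw [Matrix.det_mul]
      rcases hU with h | h <;> rcases hV with h' | h' <;> simp [h, h']
    · rw [Set.image_image]
      simp [latticeAffineMap_comp]

/-- Unimodular equivalence as an equivalence relation on the subsets of `ℝ^d`. -/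
def unimodularSetoid (d : ℕ) : Setoid (Set (Fin d → ℝ)) :=
  ⟨UnimodularlyEquivalent, unimodularlyEquivalent_equivalence d⟩

/-- The Ehrhart series `1 + ∑_{n ≥ 1} |nP ∩ ℤ^d| t^n`. -/
noncomputable def ehrhartSeries {d : ℕ} (P : Set (Fin d → ℝ)) : PowerSeries ℤ :=
  PowerSeries.mk fun n =>
    if n = 0 then 1 else ((((n : ℝ) • P) ∩ Set.range latticePoint).ncard : ℤ)

/-- `f` is the `δ`-polynomial of the `d`-dimensional lattice polytope `P ⊆ ℝ^d`. -/
def IsDeltaPolynomial {d : ℕ} (P : Set (Fin d → ℝ)) (f : Polynomial ℤ) : Prop :=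
  (f : PowerSeries ℤ) = (1 - PowerSeries.X) ^ (d + 1) * ehrhartSeries P

/-- The dual `{y : ⟨x, y⟩ ≤ 1 for all x ∈ P}`. -/
def dualPolytope {d : ℕ} (P : Set (Fin d → ℝ)) : Set (Fin d → ℝ) :=
  {y | ∀ x ∈ P, x ⬝ᵥ y ≤ 1}

/-- A reflexive polytope in `ℝ^d` (it has dimension `d`, as its interior is nonempty). -/
def IsReflexive {d : ℕ} (P : Set (Fin d → ℝ)) : Prop :=
  IsLatticePolytope P ∧ 0 ∈ interior P ∧ IsLatticePolytope (dualPolytope P)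

/-- `P` is Gorenstein (of some index `r ≥ 1`): `rP` is unimodularly equivalent to a reflexive
polytope. -/
def IsGorenstein {d : ℕ} (P : Set (Fin d → ℝ)) : Prop :=
  ∃ r : ℕ, 0 < r ∧ ∃ Q : Set (Fin d → ℝ), IsReflexive Q ∧ UnimodularlyEquivalent ((r : ℝ) • P) Q

/-- `x = (1/v_1, …, 1/v_1, 1/v_2, …, 1/v_2, …, 1/v_t, …, 1/v_t) ∈ (ℝ/ℤ)^(d+1)` for some
`t ≥ 1` and integers `1 < v_1 < ⋯ < v_t = v` with `v_i ∣ v_(i+1)`, where each `1/v_i` is repeated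
`s_i ≥ 1` times. Here `t = m + 1`, `v_(i+1) = c i`, and `b j` is the block of the coordinate `j`;
`b` is monotone and onto, so the blocks are consecutive and nonempty. -/
def IsDivisorBlockVector (v : ℕ) {d : ℕ} (x : Fin (d + 1) → AddCircle (1 : ℝ)) : Prop :=
  ∃ (m : ℕ) (c : Fin (m + 1) → ℕ) (b : Fin (d + 1) → Fin (m + 1)),
    1 < c 0 ∧ StrictMono c ∧ (∀ i : Fin m, c i.castSucc ∣ c i.succ) ∧ c (Fin.last m) = v ∧
      Monotone b ∧ Function.Surjective b ∧
      ∀ j, x j = ((1 / (c (b j) : ℝ) : ℝ) : AddCircle (1 : ℝ))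

/-- The Gorenstein simplices counted by `M(v, k)`: lattice simplices `P` of dimension `d` whose
group `Λ_P` (for some ordering of the vertices) is generated by a vector as in
`IsDivisorBlockVector`, with `δ`-polynomial `1 + t^(k+1) + ⋯ + t^((v-1)(k+1))`. -/
def IsDivisorChainSimplex (v k : ℕ) {d : ℕ} (P : Set (Fin d → ℝ)) : Prop :=
  IsGorenstein P ∧
  (∃ p : Fin (d + 1) → Fin d → ℤ, IsVertexOrdering P p ∧
    ∃ x : Fin (d + 1) → AddCircle (1 : ℝ), IsDivisorBlockVector v x ∧
      simplexGroup p = AddSubgroup.zmultiples x) ∧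
  IsDeltaPolynomial P (∑ i ∈ Finset.range v, Polynomial.X ^ (i * (k + 1)))

/-- The unimodular equivalence classes, in all dimensions `d`, of the simplices of
`IsDivisorChainSimplex v k`. -/
def divisorChainClasses (v k : ℕ) : Set (Σ d : ℕ, Quotient (unimodularSetoid d)) :=
  {q | ∃ (d : ℕ) (P : Set (Fin d → ℝ)), IsDivisorChainSimplex v k P ∧
    q = ⟨d, Quotient.mk (unimodularSetoid d) P⟩}

/-- `M(v, k)`: the number of classes in `divisorChainClasses v k`, with the convention
`M(1, k) = 1` (for `v = 1` there is no sequence `1 < v_1 < ⋯ < v_t = v` with `t ≥ 1`). -/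
noncomputable def numDivisorChainSimplices (v k : ℕ) : ℕ :=
  if v = 1 then 1 else (divisorChainClasses v k).ncard

/-- The chains (totally ordered subsets) in the divisor lattice of `v` whose smallest element is
not the least element `1` of the lattice and whose largest element is `v`. -/
def divisorChains (v : ℕ) : Set (Finset ℕ) :=
  {C | C ⊆ v.divisors ∧ IsChain (· ∣ ·) (C : Set ℕ) ∧ v ∈ C ∧ ∃ a ∈ C, a ≠ 1 ∧ ∀ b ∈ C, a ∣ b}

/-! A lattice simplex is determined up to unimodular equivalence by its group `Λ` up to a
permutation of the coordinates (`unimodularlyEquivalent_of_simplexGroup_eq`,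
`exists_perm_of_unimodularlyEquivalent`). Its δ-polynomial is the sum of `t ^ height y` over `y ∈
Λ`, where the height adds up the representatives in `[0, 1)` (`isDeltaPolynomial_convexHull_iff`).

Let `Λ` be generated by the vector with values `1/v_i` and multiplicities `s_i`. The multiple by
`a`, for `0 ≤ a < v`, has height `∑ s_i (a mod v_i) / v_i`. In the mixed radix system with place
values `V_0 = 1`, `V_i = v_i`, this is linear in the digits of `a`, the `l`-th digit having weight
`w_l = V_l ∑_{i > l} s_i / v_i` (`sum_mul_mod_eq`). Hence the δ-polynomial is a product of geometric
sums, one for each digit.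

It is the prescribed polynomial exactly when `w_l = (k + 1) v / V_{l+1}` for all `l`. Sufficiency is
a telescoping product (`sum_X_pow_weightedDigitSum`); necessity peels off the top digit, using that
`w_l / V_l` strictly decreases (`last_weight_eq`, `weight_mul_eq`). These equations determine the
`s_i` (`multiplicity_unique`) and have a solution in positive integers (`blockSize`), so each chain
carries exactly one multiplicity vector.

That vector is realised by an explicit simplex (`exists_isBlockSimplex`), the Gorenstein property is
automatic (`isGorenstein_of_simplexGroup_eq`), and equivalent simplices give the same chain because
the orders of the coordinates of a generator are invariant. So classes correspond to chains. The
recursion sorts the chains by the largest element left after deleting `v`. -/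

/-! ### Mixed radix digit sums and their generating polynomials -/

theorem sum_range_mul_eq {M : Type*} [AddCommMonoid M] (F : ℕ → M) (g n : ℕ) :
    ∑ j ∈ Finset.range (g * n), F j =
      ∑ a ∈ Finset.range n, ∑ i ∈ Finset.range g, F (g * a + i) := by
  induction n with
  | zero => simp
  | succ n ih => rw [Nat.mul_succ, Finset.sum_range_add, ih, Finset.sum_range_succ]

/-- The digits of `j` in the mixed radix system with place values `v 0, …, v (t - 1)`, weighted
by `w`. -/
def weightedDigitSum (v w : ℕ → ℕ) (t j : ℕ) : ℕ :=
  ∑ l ∈ Finset.range t, (j % v (l + 1) / v l) * w l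

theorem dvd_of_dvd_succ {v : ℕ → ℕ} {t : ℕ} (h : ∀ l < t, v l ∣ v (l + 1)) {i j : ℕ}
    (hij : i ≤ j) (hj : j ≤ t) : v i ∣ v j := by
  induction j, hij using Nat.le_induction with
  | base => exact dvd_rfl
  | succ j hij ih => exact (ih (by omega)).trans (h j (by omega))

theorem le_of_lt_succ {v : ℕ → ℕ} {t : ℕ} (h : ∀ l < t, v l < v (l + 1)) {i j : ℕ}
    (hij : i ≤ j) (hj : j ≤ t) : v i ≤ v j := by
  induction j, hij using Nat.le_induction with
  | base => exact le_rfl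
  | succ j hij ih => exact (ih (by omega)).trans (h j (by omega)).le

theorem weightedDigitSum_succ {v w : ℕ → ℕ} {t : ℕ} (hd : ∀ l < t + 1, v l ∣ v (l + 1))
    (hpos : 0 < v t) {a i : ℕ} (hi : i < v t) (hlt : v t * a + i < v (t + 1)) :
    weightedDigitSum v w (t + 1) (v t * a + i) = weightedDigitSum v w t i + a * w t := by
  unfold weightedDigitSum
  rw [Finset.sum_range_succ]
  congr 1
  · refine Finset.sum_congr rfl fun l hl => ?_
    rw [Finset.mem_range] at hl
    obtain ⟨e, he⟩ := dvd_of_dvd_succ hd (i := l + 1) (j := t) (by omega) (by omega)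
    rw [he, mul_assoc, Nat.mul_add_mod]
  · rw [Nat.mod_eq_of_lt hlt, Nat.mul_add_div hpos, Nat.div_eq_of_lt hi, add_zero]

theorem weightedDigitSum_mul {v w : ℕ → ℕ} {t : ℕ} (hd : ∀ l < t, v l ∣ v (l + 1))
    (hlt : ∀ l < t, v l < v (l + 1)) (h0 : 0 < v 0) {l q : ℕ} (hl : l < t)
    (hq : q * v l < v (l + 1)) : weightedDigitSum v w t (q * v l) = q * w l := by
  unfold weightedDigitSum
  have hpos : ∀ i ≤ t, 0 < v i := fun i hi => h0.trans_le (le_of_lt_succ hlt (Nat.zero_le i) hi)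
  rw [Finset.sum_eq_single l]
  · rw [Nat.mod_eq_of_lt hq, Nat.mul_div_cancel _ (hpos l hl.le)]
  · intro i hi hil
    rw [Finset.mem_range] at hi
    rcases lt_or_gt_of_ne hil with h | h
    · have : v (i + 1) ∣ v l := dvd_of_dvd_succ hd (by omega) (by omega)
      rw [Nat.mod_eq_zero_of_dvd (this.mul_left q)]
      simp
    · have h1 : v (l + 1) ≤ v i := le_of_lt_succ hlt (by omega) hi.le
      have h2 := hlt i hi
      rw [Nat.mod_eq_of_lt (by omega), Nat.div_eq_of_lt (by omega), zero_mul]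
  · intro h
    exact absurd (Finset.mem_range.2 hl) h

open Polynomial in
-- Writing `j = v t * a + i` with `i < v t` separates the top digit `a`, which varies independently
-- of the lower digits.
theorem sum_X_pow_weightedDigitSum_succ {v : ℕ → ℕ} (w : ℕ → ℕ) {t : ℕ}
    (hd : ∀ l < t + 1, v l ∣ v (l + 1)) (hpos : 0 < v t) {g : ℕ} (hg : v (t + 1) = v t * g) :
    (∑ j ∈ Finset.range (v (t + 1)), (X : ℤ[X]) ^ weightedDigitSum v w (t + 1) j) =
      (∑ a ∈ Finset.range g, X ^ (a * w t)) *
        ∑ j ∈ Finset.range (v t), X ^ weightedDigitSum v w t j := by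
  rw [hg, sum_range_mul_eq, Finset.sum_mul]
  refine Finset.sum_congr rfl fun a ha => ?_
  rw [Finset.mul_sum]
  refine Finset.sum_congr rfl fun i hi => ?_
  rw [Finset.mem_range] at ha hi
  rw [weightedDigitSum_succ hd hpos hi, pow_add, mul_comm]
  rw [hg]
  calc v t * a + i < v t * (a + 1) := by rw [Nat.mul_succ]; omega
    _ ≤ v t * g := Nat.mul_le_mul_left _ ha

open Polynomial in
theorem geom_sum_mul_geom_sum (g n K : ℕ) :
    (∑ a ∈ Finset.range g, (X : ℤ[X]) ^ (a * K)) * ∑ i ∈ Finset.range n, X ^ (i * (K * g)) =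
      ∑ i ∈ Finset.range (g * n), X ^ (i * K) := by
  rw [sum_range_mul_eq, Finset.sum_mul_sum, Finset.sum_comm]
  refine Finset.sum_congr rfl fun i _ => Finset.sum_congr rfl fun a _ => ?_
  rw [← pow_add]
  congr 1
  ring

open Polynomial in
-- With these weights the factors telescope: the top digit contributes a geometric sum with step
-- `K`, and the lower digits solve the same problem with step `K * g`, where `g` is the top radix.
theorem sum_X_pow_weightedDigitSum {v w : ℕ → ℕ} {t : ℕ} (K : ℕ)
    (hd : ∀ l < t, v l ∣ v (l + 1)) (hlt : ∀ l < t, v l < v (l + 1)) (h0 : v 0 = 1)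
    (hw : ∀ l < t, w l * v (l + 1) = K * v t) :
    (∑ j ∈ Finset.range (v t), (X : ℤ[X]) ^ weightedDigitSum v w t j) =
      ∑ i ∈ Finset.range (v t), X ^ (i * K) := by
  induction t generalizing K with
  | zero => simp [h0, weightedDigitSum]
  | succ t ih =>
    have hpos : 0 < v t := by
      have := le_of_lt_succ hlt (Nat.zero_le t) (by omega)
      omega
    obtain ⟨g, hg⟩ := hd t (by omega)
    have hwt : w t = K :=
      Nat.eq_of_mul_eq_mul_right (by have := hlt t (by omega); omega) (hw t (by omega))
    rw [sum_X_pow_weightedDigitSum_succ w hd hpos hg, hwt,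
      ih (K * g) (fun l hl => hd l (by omega)) (fun l hl => hlt l (by omega)),
      geom_sum_mul_geom_sum, hg, mul_comm g]
    intro l hl
    rw [hw l (by omega), hg]
    ring

/-! ### Rigidity of the weights -/

open Polynomial in
-- Comparing coefficients shows that `f` and `i ↦ i * K` have fibres of equal size, and the latter
-- map is injective.
theorem injOn_of_sum_X_pow_eq {f : ℕ → ℕ} {n K : ℕ} (hK : 0 < K)
    (h : (∑ j ∈ Finset.range n, (X : ℤ[X]) ^ f j) = ∑ i ∈ Finset.range n, X ^ (i * K)) :
    (∀ j < n, K ∣ f j) ∧ (∀ i < n, ∃ j < n, f j = i * K) ∧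
      ∀ i < n, ∀ j < n, f i = f j → i = j := by
  have key : ∀ e : ℕ, ((Finset.range n).filter fun j => f j = e).card =
      ((Finset.range n).filter fun i => i * K = e).card := by
    intro e
    have := congrArg (fun q => q.coeff e) h
    simp only [finsetSum_coeff, coeff_X_pow, Finset.sum_boole] at this
    simp only [eq_comm (a := e)] at this
    exact_mod_cast this
  refine ⟨fun j hj => ?_, fun i hi => ?_, fun i hi j hj hij => ?_⟩
  · have h1 : 0 < ((Finset.range n).filter fun i => f i = f j).card :=
      Finset.card_pos.2 ⟨j, by simp [hj]⟩
    rw [key, Finset.card_pos] at h1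
    obtain ⟨i, hi⟩ := h1
    exact ⟨i, by rw [← (Finset.mem_filter.1 hi).2, mul_comm]⟩
  · have h1 : 0 < ((Finset.range n).filter fun j => j * K = i * K).card :=
      Finset.card_pos.2 ⟨i, by simp [hi]⟩
    rw [← key, Finset.card_pos] at h1
    obtain ⟨j, hj⟩ := h1
    rw [Finset.mem_filter, Finset.mem_range] at hj
    exact ⟨j, hj⟩
  · have h1 : ((Finset.range n).filter fun l => l * K = f j).card ≤ 1 := by
      refine Finset.card_le_one.2 fun a ha b hb => ?_
      rw [Finset.mem_filter] at ha hb
      exact Nat.eq_of_mul_eq_mul_right hK (ha.2.trans hb.2.symm)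
    rw [← key] at h1
    exact Finset.card_le_one.1 h1 i (by simp [hi, hij]) j (by simp [hj])

open Polynomial in
-- All weights are positive multiples of `K`, and `K` itself is attained, so some weight equals `K`.
-- Were it not the top one, the next weight would be `q * K` with `q * v l < v (l + 1)`, by the
-- strict decrease of `w l / v l`; then `q * v l` and `v (l + 1)` would share a digit sum.
theorem last_weight_eq {v w : ℕ → ℕ} {t K : ℕ} (hK : 0 < K)
    (hd : ∀ l < t + 1, v l ∣ v (l + 1)) (hlt : ∀ l < t + 1, v l < v (l + 1)) (h0 : v 0 = 1)
    (hw : ∀ l < t, w (l + 1) * v l < v (l + 1) * w l)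
    (h : (∑ j ∈ Finset.range (v (t + 1)), (X : ℤ[X]) ^ weightedDigitSum v w (t + 1) j) =
      ∑ i ∈ Finset.range (v (t + 1)), X ^ (i * K)) : w t = K := by
  obtain ⟨hdvd, hex, hinj⟩ := injOn_of_sum_X_pow_eq hK h
  have h00 : 0 < v 0 := by omega
  have hpos : ∀ i ≤ t + 1, 0 < v i :=
    fun i hi => h00.trans_le (le_of_lt_succ hlt (Nat.zero_le i) hi)
  have hlast : ∀ l < t + 1, v l < v (t + 1) := fun l hl =>
    (hlt l hl).trans_le (le_of_lt_succ hlt (i := l + 1) (by omega) le_rfl)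
  have hzero : weightedDigitSum v w (t + 1) 0 = 0 := by simp [weightedDigitSum]
  have hval : ∀ l < t + 1, weightedDigitSum v w (t + 1) (v l) = w l := fun l hl => by
    simpa using weightedDigitSum_mul (w := w) hd hlt h00 (q := 1) hl (by simpa using hlt l hl)
  have hwpos : ∀ l < t + 1, K ∣ w l ∧ K ≤ w l := fun l hl => by
    have h1 := hdvd (v l) (hlast l hl)
    rw [hval l hl] at h1
    refine ⟨h1, Nat.le_of_dvd (Nat.pos_of_ne_zero fun h2 => ?_) h1⟩
    have := hinj (v l) (hlast l hl) 0 (hpos _ le_rfl) (by rw [hval l hl, hzero, h2])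
    exact (hpos l hl.le).ne' this
  have h1v : 1 < v (t + 1) := by have := hlast 0 (by omega); omega
  obtain ⟨j, hj, hjK⟩ := hex 1 h1v
  rw [one_mul] at hjK
  -- A nonzero digit of the index attaining `K` singles out a weight at most `K`.
  obtain ⟨l, hl, hne⟩ : ∃ l ∈ Finset.range (t + 1), (j % v (l + 1) / v l) * w l ≠ 0 := by
    by_contra! hcon
    rw [weightedDigitSum, Finset.sum_eq_zero hcon] at hjK
    omega
  have hle : (j % v (l + 1) / v l) * w l ≤ K := by
    rw [← hjK, weightedDigitSum]
    exact Finset.single_le_sum (f := fun l => (j % v (l + 1) / v l) * w l)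
      (fun _ _ => Nat.zero_le _) hl
  rw [Finset.mem_range] at hl
  have hwl : w l = K := by
    refine le_antisymm (le_trans ?_ hle) (hwpos l hl).2
    exact Nat.le_mul_of_pos_left _ (Nat.pos_of_ne_zero (left_ne_zero_of_mul hne))
  rcases Nat.lt_succ_iff_lt_or_eq.1 hl with hlt' | rfl
  · exfalso
    obtain ⟨q, hq⟩ := (hwpos (l + 1) (by omega)).1
    have h1 := hw l hlt'
    rw [hq, hwl, mul_comm (v (l + 1)), mul_assoc] at h1
    have h2 : q * v l < v (l + 1) := Nat.lt_of_mul_lt_mul_left h1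
    have h3 : weightedDigitSum v w (t + 1) (q * v l) = weightedDigitSum v w (t + 1) (v (l + 1)) := by
      rw [weightedDigitSum_mul hd hlt h00 hl h2, hval (l + 1) (by omega), hq, hwl, mul_comm]
    have := hinj _ (h2.trans (hlast (l + 1) (by omega))) _ (hlast (l + 1) (by omega)) h3
    omega
  · exact hwl

open Polynomial in
-- The top weight is `K`, so the geometric factor of the top digit cancels from both sides. What is
-- left is the same problem with one digit fewer and step `K * g`.
theorem weight_mul_eq {v w : ℕ → ℕ} {t K : ℕ} (hK : 0 < K)
    (hd : ∀ l < t, v l ∣ v (l + 1)) (hlt : ∀ l < t, v l < v (l + 1)) (h0 : v 0 = 1)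
    (hw : ∀ l, l + 1 < t → w (l + 1) * v l < v (l + 1) * w l)
    (h : (∑ j ∈ Finset.range (v t), (X : ℤ[X]) ^ weightedDigitSum v w t j) =
      ∑ i ∈ Finset.range (v t), X ^ (i * K)) : ∀ l < t, w l * v (l + 1) = K * v t := by
  induction t generalizing K with
  | zero => intro l hl; omega
  | succ t ih =>
    have hpos : 0 < v t := by
      have := le_of_lt_succ hlt (Nat.zero_le t) (by omega)
      omega
    obtain ⟨g, hg⟩ := hd t (by omega)
    have hgpos : 0 < g := Nat.pos_of_ne_zero (by
      rintro rfl
      have := hlt t (by omega)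
      omega)
    have hwt : w t = K := last_weight_eq hK hd hlt h0 (fun l hl => hw l (by omega)) h
    rw [sum_X_pow_weightedDigitSum_succ w hd hpos hg, hwt, hg, mul_comm (v t),
      ← geom_sum_mul_geom_sum] at h
    have hne : (∑ a ∈ Finset.range g, (X : ℤ[X]) ^ (a * K)) ≠ 0 := by
      intro h0
      have := congrArg (eval 1) h0
      simp [eval_finsetSum] at this
      omega
    have h' := ih (Nat.mul_pos hK hgpos) (fun l hl => hd l (by omega))
      (fun l hl => hlt l (by omega)) (fun l hl => hw l (by omega)) (mul_left_cancel₀ hne h)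
    intro l hl
    rcases Nat.lt_succ_iff_lt_or_eq.1 hl with hl' | rfl
    · rw [h' l hl', hg]
      ring
    · rw [hwt]

/-! ### Lattice points in dilated simplices and the δ-polynomial -/

/-- The vertices of a lattice simplex as an affine basis of `ℝ^d`. -/
noncomputable def vertexBasis {d : ℕ} {p : Fin (d + 1) → Fin d → ℤ}
    (h : AffineIndependent ℝ (fun i => latticePoint (p i))) :
    AffineBasis (Fin (d + 1)) ℝ (Fin d → ℝ) :=
  ⟨fun i => latticePoint (p i), h,
    h.affineSpan_eq_top_iff_card_eq_finrank_add_one.2 (by simp)⟩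

theorem vertexBasis_apply {d : ℕ} {p : Fin (d + 1) → Fin d → ℤ}
    (h : AffineIndependent ℝ (fun i => latticePoint (p i))) (i : Fin (d + 1)) :
    vertexBasis h i = latticePoint (p i) := rfl

theorem sum_coord_smul_latticePoint {d : ℕ} {p : Fin (d + 1) → Fin d → ℤ}
    (h : AffineIndependent ℝ (fun i => latticePoint (p i))) (y : Fin d → ℝ) :
    ∑ i, (vertexBasis h).coord i y • latticePoint (p i) = y :=
  (vertexBasis h).linear_combination_coord_eq_self y

theorem weights_unique {d : ℕ} {p : Fin (d + 1) → Fin d → ℤ}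
    (h : AffineIndependent ℝ (fun i => latticePoint (p i))) {μ ν : Fin (d + 1) → ℝ}
    (hs : ∑ i, μ i = ∑ i, ν i)
    (hp : ∑ i, μ i • latticePoint (p i) = ∑ i, ν i • latticePoint (p i)) : μ = ν := by
  rw [affineIndependent_iff] at h
  ext i
  have := h Finset.univ (fun i => μ i - ν i) (by simp [hs])
    (by simp [sub_smul, Finset.sum_sub_distrib, hp]) i (Finset.mem_univ i)
  exact sub_eq_zero.1 this

theorem mem_smul_convexHull_iff {d : ℕ} {p : Fin (d + 1) → Fin d → ℤ}
    (h : AffineIndependent ℝ (fun i => latticePoint (p i))) (n : ℕ) (y : Fin d → ℝ) :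
    y ∈ (n : ℝ) • convexHull ℝ (Set.range fun i => latticePoint (p i)) ↔
      ∃ μ : Fin (d + 1) → ℝ, (∀ i, 0 ≤ μ i) ∧ ∑ i, μ i = n ∧
        ∑ i, μ i • latticePoint (p i) = y := by
  constructor
  · rintro ⟨x, hx, rfl⟩
    have hx' : ∀ i, 0 ≤ (vertexBasis h).coord i x := by
      have := (vertexBasis h).convexHull_eq_nonneg_coord
      exact (Set.ext_iff.1 this x).1 hx
    refine ⟨fun i => n * (vertexBasis h).coord i x, fun i => mul_nonneg n.cast_nonneg (hx' i),
      ?_, ?_⟩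
    · rw [← Finset.mul_sum, AffineBasis.sum_coord_apply_eq_one, mul_one]
    · simp_rw [mul_smul]
      rw [← Finset.smul_sum, sum_coord_smul_latticePoint]
  · rintro ⟨μ, hμ, hn, rfl⟩
    rcases Nat.eq_zero_or_pos n with rfl | hpos
    · have h0 : ∀ i, μ i = 0 := fun i =>
        (Finset.sum_eq_zero_iff_of_nonneg fun i _ => hμ i).1 (by simpa using hn) i
          (Finset.mem_univ i)
      have hne : (convexHull ℝ (Set.range fun i => latticePoint (p i))).Nonempty :=
        (Set.range_nonempty _).convexHull
      simp [h0, Set.zero_smul_set hne]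
    · have hn0 : (n : ℝ) ≠ 0 := by positivity
      rw [Set.mem_smul_set_iff_inv_smul_mem₀ hn0, Finset.smul_sum]
      simp_rw [← mul_smul]
      refine (convex_convexHull ℝ _).sum_mem (fun i _ => mul_nonneg (by positivity) (hμ i)) ?_
        fun i _ => subset_convexHull ℝ _ ⟨i, rfl⟩
      rw [← Finset.mul_sum, hn, inv_mul_cancel₀ hn0]

theorem coe_mem_simplexGroup_iff {d : ℕ} (p : Fin (d + 1) → Fin d → ℤ) (μ : Fin (d + 1) → ℝ) :
    (fun i => (μ i : AddCircle (1 : ℝ))) ∈ simplexGroup p ↔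
      ∑ i, μ i • latticePoint (p i) ∈ Set.range (latticePoint (d := d)) ∧
        ∃ n : ℤ, ∑ i, μ i = n := by
  have hcoe : ∀ r : ℝ, (r : AddCircle (1 : ℝ)) = 0 ↔ ∃ n : ℤ, r = n := fun r => by
    rw [AddCircle.coe_eq_zero_iff]
    simp [eq_comm]
  change (∀ j, ∑ i, p i j • (μ i : AddCircle (1 : ℝ)) = 0) ∧
    ∑ i, (μ i : AddCircle (1 : ℝ)) = 0 ↔ _
  refine and_congr ?_ ?_
  · have h1 : ∀ j, (∑ i, p i j • (μ i : AddCircle (1 : ℝ)) = 0 ↔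
        ∃ n : ℤ, (∑ i, μ i • latticePoint (p i)) j = n) := fun j => by
      rw [← hcoe]
      simp only [Finset.sum_apply, Pi.smul_apply, latticePoint, smul_eq_mul]
      have : ((∑ i, μ i * (p i j : ℝ) : ℝ) : AddCircle (1 : ℝ)) =
          ∑ i, p i j • (μ i : AddCircle (1 : ℝ)) := by
        rw [← QuotientAddGroup.mk'_apply, map_sum]
        refine Finset.sum_congr rfl fun i _ => ?_
        rw [QuotientAddGroup.mk'_apply, mul_comm, ← zsmul_eq_mul, AddCircle.coe_zsmul]
      rw [this]
    simp_rw [h1]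
    constructor
    · intro hz
      choose z hz using hz
      exact ⟨z, by ext j; rw [hz]; rfl⟩
    · rintro ⟨z, hz⟩ j
      exact ⟨z j, by rw [← hz]; rfl⟩
  · rw [← hcoe]
    have : ((∑ i, μ i : ℝ) : AddCircle (1 : ℝ)) = ∑ i, (μ i : AddCircle (1 : ℝ)) := by
      rw [← QuotientAddGroup.mk'_apply, map_sum]
      rfl
    rw [this]

/-- The representative in `[0, 1)` of an element of `ℝ/ℤ`. -/
noncomputable def circleFract (y : AddCircle (1 : ℝ)) : ℝ := AddCircle.equivIco 1 0 y

theorem circleFract_coe (r : ℝ) : circleFract (r : AddCircle (1 : ℝ)) = Int.fract r := by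
  rw [circleFract, AddCircle.coe_equivIco_mk_apply, div_one, mul_one]

theorem coe_circleFract (y : AddCircle (1 : ℝ)) : (circleFract y : AddCircle (1 : ℝ)) = y :=
  (AddCircle.equivIco 1 0).symm_apply_apply y

theorem circleFract_nonneg (y : AddCircle (1 : ℝ)) : 0 ≤ circleFract y :=
  (AddCircle.equivIco 1 0 y).2.1

theorem circleFract_lt_one (y : AddCircle (1 : ℝ)) : circleFract y < 1 := by
  have := (AddCircle.equivIco 1 0 y).2.2
  exact this.trans_eq (zero_add 1)

/-- The height `∑ x_i` of an element of `Λ_Δ`, with representatives `x_i` in `[0, 1)`. -/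
noncomputable def groupHeight {d : ℕ} (y : Fin (d + 1) → AddCircle (1 : ℝ)) : ℕ :=
  ⌊∑ i, circleFract (y i)⌋₊

/-- The floor in `groupHeight` loses nothing: on the group, the sum of the representatives is an
integer. -/
theorem cast_groupHeight {d : ℕ} {p : Fin (d + 1) → Fin d → ℤ}
    {y : Fin (d + 1) → AddCircle (1 : ℝ)} (hy : y ∈ simplexGroup p) :
    (groupHeight y : ℝ) = ∑ i, circleFract (y i) := by
  have h1 : (fun i => ((circleFract (y i) : ℝ) : AddCircle (1 : ℝ))) ∈ simplexGroup p := by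
    simpa only [coe_circleFract] using hy
  obtain ⟨n, hn⟩ := ((coe_mem_simplexGroup_iff p _).1 h1).2
  have h0 : 0 ≤ ∑ i, circleFract (y i) := Finset.sum_nonneg fun i _ => circleFract_nonneg _
  rw [groupHeight, hn]
  rw [hn] at h0
  lift n to ℕ using (by exact_mod_cast h0)
  simp

/-- A lattice point of the `n`-th dilate has unique nonnegative weights of total `n`. Their
fractional parts form an element `y` of the group, and their integer parts a vector in `ℕ^(d+1)` of
total `n - groupHeight y`. -/
theorem card_smul_convexHull_inter {d : ℕ} {p : Fin (d + 1) → Fin d → ℤ}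
    (h : AffineIndependent ℝ (fun i => latticePoint (p i)))
    {G : Finset (Fin (d + 1) → AddCircle (1 : ℝ))}
    (hG : ∀ y, y ∈ G ↔ y ∈ simplexGroup p) (n : ℕ) :
    (((n : ℝ) • convexHull ℝ (Set.range fun i => latticePoint (p i))) ∩
      Set.range latticePoint).ncard =
      ∑ y ∈ G, if groupHeight y ≤ n then
        (Finset.piAntidiag (Finset.univ : Finset (Fin (d + 1))) (n - groupHeight y)).card else 0 := by
  set T : Finset (Σ _ : Fin (d + 1) → AddCircle (1 : ℝ), Fin (d + 1) → ℕ) :=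
    G.sigma fun y => if groupHeight y ≤ n then
      Finset.piAntidiag (Finset.univ : Finset (Fin (d + 1))) (n - groupHeight y) else ∅ with hT
  have hmem : ∀ u, u ∈ T ↔ u.1 ∈ simplexGroup p ∧ groupHeight u.1 + ∑ i, u.2 i = n := by
    rintro ⟨y, a⟩
    rw [hT, Finset.mem_sigma, hG]
    refine and_congr_right fun _ => ?_
    dsimp only
    split_ifs with hle
    · simp only [Finset.mem_piAntidiag]
      constructor
      · rintro ⟨h1, -⟩
        change ∑ i, a i = _ at h1
        omega
      · intro h1
        refine ⟨?_, by simp⟩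
        change ∑ i, a i = _
        omega
    · simp only [Finset.notMem_empty, false_iff]
      omega
  have hcard : T.card = ∑ y ∈ G, if groupHeight y ≤ n then
      (Finset.piAntidiag (Finset.univ : Finset (Fin (d + 1))) (n - groupHeight y)).card else 0 := by
    rw [hT, Finset.card_sigma]
    refine Finset.sum_congr rfl fun y _ => ?_
    split_ifs <;> simp
  rw [← hcard, ← Set.ncard_coe_finset]
  symm
  refine Set.ncard_congr
    (fun u _ => ∑ i, (circleFract (u.1 i) + (u.2 i : ℝ)) • latticePoint (p i)) ?_ ?_ ?_
  · rintro ⟨y, a⟩ hu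
    obtain ⟨hy, hn⟩ := (hmem _).1 hu
    have hsum : ∑ i, (circleFract (y i) + (a i : ℝ)) = n := by
      rw [Finset.sum_add_distrib, ← cast_groupHeight hy, ← hn]
      push_cast
      rfl
    refine ⟨(mem_smul_convexHull_iff h n _).2 ⟨_, fun i => ?_, hsum, rfl⟩, ?_⟩
    · exact add_nonneg (circleFract_nonneg _) (Nat.cast_nonneg _)
    · refine ((coe_mem_simplexGroup_iff p fun i => circleFract (y i) + (a i : ℝ)).1 ?_).1
      have : (fun i => ((circleFract (y i) + (a i : ℝ) : ℝ) : AddCircle (1 : ℝ))) = y := by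
        ext i
        rw [AddCircle.coe_add, coe_circleFract]
        have : ((a i : ℝ) : AddCircle (1 : ℝ)) = 0 :=
          (AddCircle.coe_eq_zero_iff 1).2 ⟨a i, by simp⟩
        rw [this, add_zero]
      rw [this]
      exact hy
  · rintro ⟨y, a⟩ ⟨y', a'⟩ hu hu' heq
    obtain ⟨hy, hn⟩ := (hmem _).1 hu
    obtain ⟨hy', hn'⟩ := (hmem _).1 hu'
    have hfun := weights_unique h (by
      rw [Finset.sum_add_distrib, Finset.sum_add_distrib, ← cast_groupHeight hy,
        ← cast_groupHeight hy']
      exact_mod_cast hn.trans hn'.symm) heq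
    have hval : ∀ i, circleFract (y i) = circleFract (y' i) ∧ a i = a' i := fun i => by
      have h1 := congrFun hfun i
      have h2 := congrArg Int.fract h1
      simp only [Int.fract_add_natCast] at h2
      rw [Int.fract_eq_self.2 ⟨circleFract_nonneg _, circleFract_lt_one _⟩,
        Int.fract_eq_self.2 ⟨circleFract_nonneg _, circleFract_lt_one _⟩] at h2
      dsimp only at h1
      rw [h2] at h1
      exact ⟨h2, by exact_mod_cast add_left_cancel h1⟩
    have e1 : y = y' := by
      ext i
      rw [← coe_circleFract (y i), (hval i).1, coe_circleFract]
    have e2 : a = a' := funext fun i => (hval i).2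
    rw [e1, e2]
  · rintro x ⟨hx, hx'⟩
    obtain ⟨μ, hμ, hn, rfl⟩ := (mem_smul_convexHull_iff h n _).1 hx
    have hdec : ∀ i, circleFract (μ i : AddCircle (1 : ℝ)) + (⌊μ i⌋₊ : ℝ) = μ i := fun i => by
      rw [circleFract_coe, natCast_floor_eq_intCast_floor (hμ i), Int.fract_add_floor]
    have hy : (fun i => (μ i : AddCircle (1 : ℝ))) ∈ simplexGroup p :=
      (coe_mem_simplexGroup_iff p μ).2 ⟨hx', n, by simpa using hn⟩
    refine ⟨⟨fun i => (μ i : AddCircle (1 : ℝ)), fun i => ⌊μ i⌋₊⟩, (hmem _).2 ⟨hy, ?_⟩, ?_⟩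
    · have : ((groupHeight (fun i => (μ i : AddCircle (1 : ℝ))) + ∑ i, ⌊μ i⌋₊ : ℕ) : ℝ) = n := by
        push_cast
        rw [cast_groupHeight hy, ← Finset.sum_add_distrib, ← hn]
        exact Finset.sum_congr rfl fun i _ => hdec i
      exact_mod_cast this
    · exact Finset.sum_congr rfl fun i _ => by dsimp only; rw [hdec]

theorem coeff_mk_one_pow (d m : ℕ) :
    PowerSeries.coeff m ((PowerSeries.mk 1 : PowerSeries ℤ) ^ d) =
      (Finset.piAntidiag (Finset.univ : Finset (Fin d)) m).card := by
  have h1 : (PowerSeries.mk 1 : PowerSeries ℤ) ^ d =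
      ∏ _i ∈ (Finset.univ : Finset (Fin d)), PowerSeries.mk 1 := by simp
  rw [h1, PowerSeries.coeff_prod]
  simp only [PowerSeries.coeff_mk, Pi.one_apply, Finset.prod_const_one, Finset.sum_const,
    nsmul_eq_mul, mul_one]
  norm_cast
  refine Finset.card_bij (fun f _ => ⇑f) ?_ ?_ ?_
  · intro f hf
    rw [Finset.mem_finsuppAntidiag] at hf
    simp [Finset.mem_piAntidiag, hf.1]
  · intro f _ g _ hfg
    exact DFunLike.coe_injective hfg
  · intro f hf
    rw [Finset.mem_piAntidiag] at hf
    exact ⟨Finsupp.equivFunOnFinite.symm f, by simp [Finset.mem_finsuppAntidiag, hf.1], by simp⟩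

theorem ehrhartSeries_convexHull {d : ℕ} {p : Fin (d + 1) → Fin d → ℤ}
    (h : AffineIndependent ℝ (fun i => latticePoint (p i)))
    {G : Finset (Fin (d + 1) → AddCircle (1 : ℝ))}
    (hG : ∀ y, y ∈ G ↔ y ∈ simplexGroup p) :
    ehrhartSeries (convexHull ℝ (Set.range fun i => latticePoint (p i))) =
      (∑ y ∈ G, PowerSeries.X ^ groupHeight y) * PowerSeries.mk 1 ^ (d + 1) := by
  ext n
  rw [Finset.sum_mul, map_sum]
  simp_rw [PowerSeries.coeff_X_pow_mul', coeff_mk_one_pow]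
  have h1 := card_smul_convexHull_inter h hG n
  rw [ehrhartSeries, PowerSeries.coeff_mk]
  -- The convention at `n = 0` agrees with the general count, since the zeroth dilate is `{0}`.
  have h2 : (if n = 0 then 1 else
      ((((n : ℝ) • convexHull ℝ (Set.range fun i => latticePoint (p i))) ∩
        Set.range latticePoint).ncard : ℤ)) =
      ((((n : ℝ) • convexHull ℝ (Set.range fun i => latticePoint (p i))) ∩
        Set.range latticePoint).ncard : ℤ) := by
    split_ifs with h0
    · subst h0
      have hne : (convexHull ℝ (Set.range fun i => latticePoint (p i))).Nonempty :=
        (Set.range_nonempty _).convexHull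
      have : (((0 : ℕ) : ℝ) • convexHull ℝ (Set.range fun i => latticePoint (p i))) ∩
          Set.range latticePoint = {0} := by
        rw [Nat.cast_zero, Set.zero_smul_set hne]
        refine Set.inter_eq_left.2 fun x hx => ⟨0, ?_⟩
        rw [Set.mem_zero.1 hx]
        ext j
        simp [latticePoint]
      rw [this, Set.ncard_singleton]
      rfl
    · rfl
  rw [h2, h1]
  push_cast
  rfl

theorem isDeltaPolynomial_convexHull_iff {d : ℕ} {p : Fin (d + 1) → Fin d → ℤ}
    (h : AffineIndependent ℝ (fun i => latticePoint (p i)))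
    {G : Finset (Fin (d + 1) → AddCircle (1 : ℝ))}
    (hG : ∀ y, y ∈ G ↔ y ∈ simplexGroup p) (f : Polynomial ℤ) :
    IsDeltaPolynomial (convexHull ℝ (Set.range fun i => latticePoint (p i))) f ↔
      ∑ y ∈ G, Polynomial.X ^ groupHeight y = f := by
  have h1 : (1 - PowerSeries.X : PowerSeries ℤ) ^ (d + 1) * PowerSeries.mk 1 ^ (d + 1) = 1 := by
    rw [← mul_pow, mul_comm, PowerSeries.mk_one_mul_one_sub_eq_one, one_pow]
  have h2 : ((∑ y ∈ G, Polynomial.X ^ groupHeight y : Polynomial ℤ) : PowerSeries ℤ) =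
      ∑ y ∈ G, PowerSeries.X ^ groupHeight y := by
    rw [← Polynomial.coeToPowerSeries.ringHom_apply, map_sum]
    simp
  rw [IsDeltaPolynomial, ehrhartSeries_convexHull h hG, mul_left_comm, h1, mul_one, ← h2,
    Polynomial.coe_inj, eq_comm]

/-! ### The group as an invariant of unimodular equivalence -/

theorem latticePoint_injective {d : ℕ} : Function.Injective (latticePoint (d := d)) := by
  intro z w h
  ext i
  exact Int.cast_injective (congrFun h i : (z i : ℝ) = w i)

theorem latticePoint_single {d : ℕ} (l : Fin d) :
    latticePoint (Pi.single l 1) = Pi.single l (1 : ℝ) := by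
  ext i
  by_cases h : i = l
  · subst h
    simp [latticePoint]
  · simp [latticePoint, h]

theorem latticePoint_zero {d : ℕ} : latticePoint (0 : Fin d → ℤ) = 0 := by
  ext i
  simp [latticePoint]

/-- The gradient of the `i`-th barycentric coordinate of a lattice simplex. -/
noncomputable def coordGradient {d : ℕ} {p : Fin (d + 1) → Fin d → ℤ}
    (h : AffineIndependent ℝ (fun i => latticePoint (p i))) (i : Fin (d + 1)) : Fin d → ℝ :=
  fun l => (vertexBasis h).coord i (Pi.single l 1) - (vertexBasis h).coord i 0

theorem coord_eq_dotProduct_coordGradient {d : ℕ} {p : Fin (d + 1) → Fin d → ℤ}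
    (h : AffineIndependent ℝ (fun i => latticePoint (p i))) (i : Fin (d + 1)) (y : Fin d → ℝ) :
    (vertexBasis h).coord i y = y ⬝ᵥ coordGradient h i + (vertexBasis h).coord i 0 := by
  have hlin : ∀ x, (vertexBasis h).coord i x =
      ((vertexBasis h).coord i).linear x + (vertexBasis h).coord i 0 := fun x =>
    congrFun ((vertexBasis h).coord i).decomp x
  rw [hlin]
  congr 1
  rw [LinearMap.pi_apply_eq_sum_univ, dotProduct]
  refine Finset.sum_congr rfl fun l _ => ?_
  rw [coordGradient, hlin (Pi.single l 1), add_sub_cancel_right, smul_eq_mul]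
  congr 2
  ext j
  simp [Pi.single_apply, eq_comm]

theorem coe_coord_mem_simplexGroup {d : ℕ} {p : Fin (d + 1) → Fin d → ℤ}
    (h : AffineIndependent ℝ (fun i => latticePoint (p i))) (z : Fin d → ℤ) :
    (fun i => ((vertexBasis h).coord i (latticePoint z) : AddCircle (1 : ℝ))) ∈
      simplexGroup p := by
  rw [coe_mem_simplexGroup_iff p fun i => (vertexBasis h).coord i (latticePoint z),
    sum_coord_smul_latticePoint]
  exact ⟨⟨z, rfl⟩, 1, by rw [AffineBasis.sum_coord_apply_eq_one, Int.cast_one]⟩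

/-- The affine map with `p i ↦ q i` is integral: modulo 1, the barycentric coordinates of a lattice
point lie in the group of `p`, hence in that of `q`, so the image is again a lattice point. The
images of `0` and of the unit vectors give `w` and `U`. -/
theorem exists_latticeAffineMap {d : ℕ} {p q : Fin (d + 1) → Fin d → ℤ}
    (hp : AffineIndependent ℝ (fun i => latticePoint (p i)))
    (hpq : simplexGroup p ≤ simplexGroup q) :
    ∃ (U : Matrix (Fin d) (Fin d) ℤ) (w : Fin d → ℤ),
      ∀ y, latticeAffineMap U w y = ∑ i, (vertexBasis hp).coord i y • latticePoint (q i) := by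
  have hint : ∀ z : Fin d → ℤ, ∃ z' : Fin d → ℤ, latticePoint z' =
      ∑ i, (vertexBasis hp).coord i (latticePoint z) • latticePoint (q i) := fun z =>
    ((coe_mem_simplexGroup_iff q fun i => (vertexBasis hp).coord i (latticePoint z)).1
      (hpq (coe_coord_mem_simplexGroup hp z))).1
  obtain ⟨w, hw⟩ := hint 0
  choose u hu using fun l : Fin d => hint (Pi.single l 1)
  refine ⟨Matrix.of fun l => u l - w, w, fun y => ?_⟩
  rw [latticePoint_zero] at hw
  simp_rw [latticePoint_single] at hu
  have hU : ∀ l j, ((u l - w) j : ℝ) = ∑ i, coordGradient hp i l * (q i j : ℝ) := fun l j => by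
    have h1 := congrFun (hu l) j
    have h2 := congrFun hw j
    simp only [latticePoint, Finset.sum_apply, Pi.smul_apply, smul_eq_mul] at h1 h2
    rw [Pi.sub_apply, Int.cast_sub, h1, h2, ← Finset.sum_sub_distrib]
    exact Finset.sum_congr rfl fun i _ => by rw [coordGradient, sub_mul]
  simp_rw [coord_eq_dotProduct_coordGradient hp _ y, add_smul, Finset.sum_add_distrib, ← hw]
  rw [latticeAffineMap]
  congr 1
  ext j
  simp only [Matrix.vecMul, dotProduct, Matrix.map_apply, Matrix.of_apply, Int.coe_castRingHom,
    hU, Finset.sum_apply, Pi.smul_apply, smul_eq_mul, latticePoint]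
  simp_rw [Finset.mul_sum, Finset.sum_mul]
  rw [Finset.sum_comm]
  exact Finset.sum_congr rfl fun i _ => Finset.sum_congr rfl fun l _ => by ring

theorem latticeAffineMap_sum {d : ℕ} {ι : Type*} (s : Finset ι) (U : Matrix (Fin d) (Fin d) ℤ)
    (w : Fin d → ℤ) (μ : ι → ℝ) (P : ι → Fin d → ℝ) (hμ : ∑ i ∈ s, μ i = 1) :
    latticeAffineMap U w (∑ i ∈ s, μ i • P i) = ∑ i ∈ s, μ i • latticeAffineMap U w (P i) := by
  simp only [latticeAffineMap, smul_add, Finset.sum_add_distrib]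
  rw [← Finset.sum_smul, hμ, one_smul, Matrix.sum_vecMul]
  simp_rw [Matrix.smul_vecMul]

theorem isUnit_of_latticeAffineMap_leftInverse {d : ℕ} {U V : Matrix (Fin d) (Fin d) ℤ}
    {w z : Fin d → ℤ} (h : ∀ y, latticeAffineMap V z (latticeAffineMap U w y) = y) :
    U.det = 1 ∨ U.det = -1 := by
  simp_rw [latticeAffineMap_comp] at h
  have hUV : U * V = 1 := by
    have h0 := h 0
    rw [latticeAffineMap, Matrix.zero_vecMul, zero_add] at h0
    ext i j
    have h1 := congrFun (h (Pi.single i 1)) j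
    rw [latticeAffineMap, h0, add_zero, Matrix.single_one_vecMul] at h1
    have h2 : ((U * V) i j : ℝ) = Pi.single (M := fun _ => ℝ) i 1 j := h1
    rw [Matrix.one_apply]
    rw [Pi.single_apply] at h2
    simp only [eq_comm (a := j)] at h2
    split_ifs at h2 ⊢ <;> exact_mod_cast h2
  have hdet : U.det * V.det = 1 := by rw [← Matrix.det_mul, hUV, Matrix.det_one]
  exact Int.isUnit_iff.1 (IsUnit.of_mul_eq_one _ hdet)

theorem coord_latticePoint {d : ℕ} {p : Fin (d + 1) → Fin d → ℤ}
    (h : AffineIndependent ℝ (fun i => latticePoint (p i))) (i j : Fin (d + 1)) :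
    (vertexBasis h).coord i (latticePoint (p j)) = if i = j then 1 else 0 := by
  rw [← vertexBasis_apply h, AffineBasis.coord_apply]

theorem latticeAffineMap_image_convexHull {d : ℕ} {ι : Type*} (U : Matrix (Fin d) (Fin d) ℤ)
    (w : Fin d → ℤ) (P : ι → Fin d → ℝ) :
    latticeAffineMap U w '' convexHull ℝ (Set.range P) =
      convexHull ℝ (Set.range fun i => latticeAffineMap U w (P i)) := by
  let A : (Fin d → ℝ) →ᵃ[ℝ] (Fin d → ℝ) :=
    (Matrix.vecMulLinear (U.map (Int.castRingHom ℝ))).toAffineMap +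
      AffineMap.const ℝ _ (latticePoint w)
  have hA : latticeAffineMap U w = A := by
    ext y
    rfl
  rw [hA, AffineMap.image_convexHull, ← Set.range_comp]
  rfl

/-- Simplices with the same group are unimodularly equivalent. -/
theorem unimodularlyEquivalent_of_simplexGroup_eq {d : ℕ} {p q : Fin (d + 1) → Fin d → ℤ}
    (hp : AffineIndependent ℝ (fun i => latticePoint (p i)))
    (hq : AffineIndependent ℝ (fun i => latticePoint (q i)))
    (hpq : simplexGroup p = simplexGroup q) :
    UnimodularlyEquivalent (convexHull ℝ (Set.range fun i => latticePoint (p i)))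
      (convexHull ℝ (Set.range fun i => latticePoint (q i))) := by
  obtain ⟨U, w, hU⟩ := exists_latticeAffineMap hp hpq.le
  obtain ⟨V, z, hV⟩ := exists_latticeAffineMap hq hpq.ge
  have hUp : ∀ i, latticeAffineMap U w (latticePoint (p i)) = latticePoint (q i) := fun i => by
    simp [hU, coord_latticePoint, ite_smul]
  have hVq : ∀ i, latticeAffineMap V z (latticePoint (q i)) = latticePoint (p i) := fun i => by
    simp [hV, coord_latticePoint, ite_smul]
  refine ⟨U, w, isUnit_of_latticeAffineMap_leftInverse (w := w) (V := V) (z := z) fun y => ?_, ?_⟩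
  · rw [hU, latticeAffineMap_sum _ _ _ _ _ ((vertexBasis hp).sum_coord_apply_eq_one y)]
    simp_rw [hVq]
    exact sum_coord_smul_latticePoint hp y
  · rw [latticeAffineMap_image_convexHull]
    simp_rw [hUp]

theorem latticeAffineMap_latticePoint {d : ℕ} (U : Matrix (Fin d) (Fin d) ℤ) (w z : Fin d → ℤ) :
    latticeAffineMap U w (latticePoint z) = latticePoint (Matrix.vecMul z U + w) := by
  rw [latticeAffineMap, latticePoint_vecMul]
  ext i
  simp [latticePoint]

/-- The `i`-th barycentric coordinate reaches 1 on the simplex only at `p i`. If no `q j` were that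
vertex, the coordinate would stay below 1 on the hull of the `q j`. -/
theorem vertex_mem_range_of_convexHull_subset {d : ℕ} {p q : Fin (d + 1) → Fin d → ℤ}
    (hp : AffineIndependent ℝ (fun i => latticePoint (p i)))
    (hpq : convexHull ℝ (Set.range fun i => latticePoint (p i)) =
      convexHull ℝ (Set.range fun i => latticePoint (q i))) (i : Fin (d + 1)) :
    ∃ j, q j = p i := by
  by_contra! hcon
  set B := vertexBasis hp with hB
  have hqj : ∀ j k, 0 ≤ B.coord k (latticePoint (q j)) := fun j => by
    have h1 : latticePoint (q j) ∈ convexHull ℝ (Set.range fun i => latticePoint (p i)) := by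
      rw [hpq]
      exact subset_convexHull ℝ _ ⟨j, rfl⟩
    exact (Set.ext_iff.1 B.convexHull_eq_nonneg_coord _).1 h1
  have hlt : ∀ j, B.coord i (latticePoint (q j)) < 1 := fun j => by
    have hsum := B.sum_coord_apply_eq_one (latticePoint (q j))
    rw [Finset.sum_eq_add_sum_sdiff_singleton_of_mem (Finset.mem_univ i)] at hsum
    have hnn : 0 ≤ ∑ k ∈ Finset.univ \ {i}, B.coord k (latticePoint (q j)) :=
      Finset.sum_nonneg fun k _ => hqj j k
    refine lt_of_le_of_ne (by linarith) fun h1 => hcon j ?_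
    have h0 : ∀ k ∈ Finset.univ \ {i}, B.coord k (latticePoint (q j)) = 0 :=
      (Finset.sum_eq_zero_iff_of_nonneg fun k _ => hqj j k).1 (by linarith)
    refine latticePoint_injective (B.ext_elem fun k => ?_)
    rw [coord_latticePoint]
    split_ifs with hk
    · rw [hk, h1]
    · exact h0 k (by simp [hk])
  have hmem : latticePoint (p i) ∈ convexHull ℝ (Set.range fun i => latticePoint (q i)) := by
    rw [← hpq]
    exact subset_convexHull ℝ _ ⟨i, rfl⟩
  have hconv : Convex ℝ {y | B.coord i y < 1} := by
    have : {y | B.coord i y < 1} = B.coord i ⁻¹' Set.Iio 1 := rfl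
    rw [this]
    exact (convex_Iio 1).affine_preimage _
  have h2 : B.coord i (latticePoint (p i)) < 1 :=
    convexHull_min (by rintro _ ⟨j, rfl⟩; exact hlt j) hconv hmem
  rw [coord_latticePoint, if_pos rfl] at h2
  exact lt_irrefl _ h2

theorem simplexGroup_le_of_affine {d : ℕ} (p : Fin (d + 1) → Fin d → ℤ)
    (U : Matrix (Fin d) (Fin d) ℤ) (w : Fin d → ℤ) :
    simplexGroup p ≤ simplexGroup fun i => Matrix.vecMul (p i) U + w := by
  rintro x ⟨hx, hx'⟩
  refine ⟨fun j => ?_, hx'⟩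
  simp only [Pi.add_apply, Matrix.vecMul, dotProduct, add_smul, Finset.sum_add_distrib,
    Finset.sum_smul]
  -- The condition `∑ x i = 0` removes the translation `w`.
  rw [← Finset.smul_sum, hx', smul_zero, add_zero, Finset.sum_comm]
  refine Finset.sum_eq_zero fun l _ => ?_
  simp_rw [mul_comm (p _ l), mul_smul]
  rw [← Finset.smul_sum, hx l, smul_zero]

theorem simplexGroup_affine {d : ℕ} (p : Fin (d + 1) → Fin d → ℤ)
    {U : Matrix (Fin d) (Fin d) ℤ} (hU : IsUnit U.det) (w : Fin d → ℤ) :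
    (simplexGroup fun i => Matrix.vecMul (p i) U + w) = simplexGroup p := by
  refine le_antisymm ?_ (simplexGroup_le_of_affine p U w)
  have h := simplexGroup_le_of_affine (fun i => Matrix.vecMul (p i) U + w) U⁻¹
    (-Matrix.vecMul w U⁻¹)
  simpa [Matrix.add_vecMul, Matrix.mul_nonsing_inv U hU] using h

/-- The groups of unimodularly equivalent simplices agree up to a permutation of the vertices. -/
theorem exists_perm_of_unimodularlyEquivalent {d : ℕ} {P Q : Set (Fin d → ℝ)}
    {p q : Fin (d + 1) → Fin d → ℤ} (hp : IsVertexOrdering P p) (hq : IsVertexOrdering Q q)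
    (h : UnimodularlyEquivalent P Q) :
    ∃ σ : Equiv.Perm (Fin (d + 1)), ∀ x, x ∘ σ ∈ simplexGroup p ↔ x ∈ simplexGroup q := by
  obtain ⟨V, z, hV, hP⟩ := (unimodularlyEquivalent_equivalence d).symm h
  have hunit : IsUnit V.det := Int.isUnit_iff.2 hV
  obtain ⟨hp, rfl⟩ := hp
  obtain ⟨hq, rfl⟩ := hq
  rw [latticeAffineMap_image_convexHull] at hP
  simp_rw [latticeAffineMap_latticePoint] at hP
  choose σ hσ using fun i => vertex_mem_range_of_convexHull_subset hp hP i
  have hinj : Function.Injective σ := fun i j hij => by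
    have : p i = p j := by rw [← hσ i, ← hσ j, hij]
    exact hp.injective (by simp [this])
  have hbij : Function.Bijective σ := Finite.injective_iff_bijective.1 hinj
  refine ⟨Equiv.ofBijective σ hbij, fun x => ?_⟩
  rw [← simplexGroup_affine q hunit z]
  refine and_congr (forall_congr' fun j => ?_) ?_
  · rw [← hbij.sum_comp (fun i => (Matrix.vecMul (q i) V + z) j • x i)]
    simp_rw [hσ]
    rfl
  · rw [← hbij.sum_comp x]
    rfl

/-! ### The Gorenstein property -/

theorem isLatticePolytope_convexHull_range {d : ℕ} {ι : Type*} [Fintype ι] (q : ι → Fin d → ℤ) :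
    IsLatticePolytope (convexHull ℝ (Set.range fun i => latticePoint (q i))) := by
  classical
  refine ⟨Finset.univ.image q, ?_⟩
  rw [Finset.coe_image, Finset.coe_univ, Set.image_univ, ← Set.range_comp]
  rfl

theorem mem_dualPolytope_convexHull_range {d : ℕ} {ι : Type*} (P : ι → Fin d → ℝ)
    (y : Fin d → ℝ) :
    y ∈ dualPolytope (convexHull ℝ (Set.range P)) ↔ ∀ i, P i ⬝ᵥ y ≤ 1 := by
  refine ⟨fun h i => h _ (subset_convexHull ℝ _ ⟨i, rfl⟩), fun h x hx => ?_⟩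
  have hconv : Convex ℝ {x : Fin d → ℝ | x ⬝ᵥ y ≤ 1} := by
    intro a ha b hb s t hs ht hst
    simp only [Set.mem_ofPred_eq, add_dotProduct, smul_dotProduct, smul_eq_mul] at *
    nlinarith
  exact convexHull_min (by rintro _ ⟨i, rfl⟩; exact h i) hconv hx

/-- Modulo 1, the coordinates of a lattice point form a multiple of the generator, so the `j`-th one
is `a / c j` up to an integer. This makes the dual vertices integral. -/
theorem exists_int_mul_coord {d : ℕ} {p : Fin (d + 1) → Fin d → ℤ}
    (h : AffineIndependent ℝ (fun i => latticePoint (p i))) {c : Fin (d + 1) → ℕ}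
    (hc : ∀ i, 0 < c i)
    (hG : simplexGroup p =
      AddSubgroup.zmultiples fun i => ((1 / (c i : ℝ) : ℝ) : AddCircle (1 : ℝ)))
    (j : Fin (d + 1)) (z : Fin d → ℤ) :
    ∃ n : ℤ, (c j : ℝ) * (vertexBasis h).coord j (latticePoint z) = n := by
  have h1 := coe_coord_mem_simplexGroup h z
  rw [hG, AddSubgroup.mem_zmultiples_iff] at h1
  obtain ⟨a, ha⟩ := h1
  have h2 := congrFun ha j
  rw [Pi.smul_apply, ← AddCircle.coe_zsmul, ← sub_eq_zero, ← AddCircle.coe_sub,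
    AddCircle.coe_eq_zero_iff] at h2
  obtain ⟨n, hn⟩ := h2
  have hcj : (c j : ℝ) ≠ 0 := by exact_mod_cast (hc j).ne'
  refine ⟨a - c j * n, ?_⟩
  rw [zsmul_eq_mul, zsmul_eq_mul, mul_one] at hn
  push_cast
  rw [hn]
  field_simp
  ring

theorem affineIndependent_iff_sum_smul {ι : Type*} [Fintype ι] {d : ℕ} {P : ι → Fin d → ℝ} :
    AffineIndependent ℝ P ↔
      ∀ w : ι → ℝ, ∑ i, w i = 0 → ∑ i, w i • P i = 0 → ∀ i, w i = 0 := by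
  rw [affineIndependent_iff_of_fintype]
  refine forall_congr' fun w => forall_congr' fun hw => ?_
  rw [Finset.weightedVSub_eq_linear_combination _ hw]

/-- A lattice simplex whose group is generated by `(1/c_0, …, 1/c_d)` is Gorenstein. -/
theorem isGorenstein_of_simplexGroup_eq {d : ℕ} {p : Fin (d + 1) → Fin d → ℤ}
    (h : AffineIndependent ℝ (fun i => latticePoint (p i))) {c : Fin (d + 1) → ℕ}
    (hc : ∀ i, 0 < c i)
    (hG : simplexGroup p =
      AddSubgroup.zmultiples fun i => ((1 / (c i : ℝ) : ℝ) : AddCircle (1 : ℝ))) :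
    IsGorenstein (convexHull ℝ (Set.range fun i => latticePoint (p i))) := by
  have hc0 : ∀ i, (c i : ℝ) ≠ 0 := fun i => by exact_mod_cast (hc i).ne'
  -- The generator itself yields the lattice point `z = ∑ p i / c i` and the integer `r = ∑ 1 / c
  -- i`; the polytope `r P - z` is shown to be reflexive.
  obtain ⟨⟨z, hz⟩, n, hn⟩ := (coe_mem_simplexGroup_iff p fun i => 1 / (c i : ℝ)).1
    (hG ▸ AddSubgroup.mem_zmultiples _)
  have hpos : (0 : ℝ) < ∑ i, 1 / (c i : ℝ) :=
    Finset.sum_pos (fun i _ => by have := hc i; positivity) Finset.univ_nonempty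
  obtain ⟨r, hr⟩ : ∃ r : ℕ, ∑ i, 1 / (c i : ℝ) = r := by
    rw [hn] at hpos
    lift n to ℕ using by exact_mod_cast hpos.le
    exact ⟨n, by rw [hn]; rfl⟩
  rw [hr] at hpos
  have hr0 : (r : ℝ) ≠ 0 := hpos.ne'
  set q : Fin (d + 1) → Fin d → ℤ := fun i => (r : ℤ) • p i - z with hq
  have hqp : ∀ i, latticePoint (q i) = (r : ℝ) • latticePoint (p i) - latticePoint z := fun i => by
    ext l
    simp [hq, latticePoint]
  have hQ : latticeAffineMap 1 (-z) '' ((r : ℝ) • convexHull ℝ (Set.range fun i =>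
      latticePoint (p i))) = convexHull ℝ (Set.range fun i => latticePoint (q i)) := by
    rw [← convexHull_smul, Set.smul_set_range, latticeAffineMap_image_convexHull]
    congr 2
    ext1 i
    rw [hqp]
    ext l
    simp [latticeAffineMap, latticePoint, sub_eq_add_neg]
  have hqind : AffineIndependent ℝ (fun i => latticePoint (q i)) := by
    rw [affineIndependent_iff_sum_smul] at h ⊢
    intro w hw hwq
    refine h w hw ?_
    simp_rw [hqp, smul_sub, Finset.sum_sub_distrib] at hwq
    rw [← Finset.sum_smul, hw, zero_smul, sub_zero] at hwq
    simp_rw [smul_comm _ (r : ℝ)] at hwq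
    rw [← Finset.smul_sum] at hwq
    exact (smul_eq_zero.1 hwq).resolve_left hr0
  have hsum : ∑ i, (1 / (c i : ℝ)) • latticePoint (q i) = 0 := by
    simp_rw [hqp, smul_sub, Finset.sum_sub_distrib, smul_comm _ (r : ℝ)]
    rw [← Finset.smul_sum, ← Finset.sum_smul, hr, ← hz, sub_self]
  have hcoord0 : (fun i => (vertexBasis hqind).coord i 0) = fun i => 1 / (c i : ℝ) / r := by
    refine weights_unique hqind ?_ ?_
    · rw [AffineBasis.sum_coord_apply_eq_one, ← Finset.sum_div, hr, div_self hr0]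
    · rw [sum_coord_smul_latticePoint]
      simp_rw [div_eq_inv_mul _ (r : ℝ), mul_smul]
      rw [← Finset.smul_sum, hsum, smul_zero]
  have hgrad : ∀ i j, latticePoint (q i) ⬝ᵥ coordGradient h j =
      (if j = i then (r : ℝ) else 0) - 1 / c j := fun i j => by
    have h1 : ∀ k, latticePoint (p k) ⬝ᵥ coordGradient h j =
        (if j = k then 1 else 0) - (vertexBasis h).coord j 0 := fun k => by
      have := coord_eq_dotProduct_coordGradient h j (latticePoint (p k))
      rw [coord_latticePoint] at this
      linarith
    have h2 : latticePoint z ⬝ᵥ coordGradient h j = 1 / c j - r * (vertexBasis h).coord j 0 := by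
      rw [hz, sum_dotProduct]
      simp_rw [smul_dotProduct, h1, smul_sub, Finset.sum_sub_distrib]
      rw [← Finset.sum_smul, hr]
      simp
    rw [hqp, sub_dotProduct, smul_dotProduct, h1, h2, smul_eq_mul]
    split_ifs <;> ring
  have hint : ∀ j l, ∃ m : ℤ, (m : ℝ) = -(c j : ℝ) * coordGradient h j l := fun j l => by
    obtain ⟨a, ha⟩ := exists_int_mul_coord h hc hG j (Pi.single l 1)
    obtain ⟨b, hb⟩ := exists_int_mul_coord h hc hG j 0
    rw [latticePoint_single] at ha
    rw [latticePoint_zero] at hb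
    refine ⟨b - a, ?_⟩
    rw [coordGradient]
    push_cast
    rw [← ha, ← hb]
    ring
  choose u hu using hint
  have hu' : ∀ j, latticePoint (u j) = -(c j : ℝ) • coordGradient h j := fun j => by
    ext l
    exact hu j l
  -- Thus `u j` equals 1 on the facet opposite to `q j`: the `u j` are the candidates for the dual
  -- vertices.
  have hqu : ∀ i j, latticePoint (q i) ⬝ᵥ latticePoint (u j) =
      1 - if j = i then (r : ℝ) * c j else 0 := fun i j => by
    rw [hu', dotProduct_smul, hgrad, smul_eq_mul]
    have := hc0 j
    split_ifs <;> field_simp <;> ring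
  have hdual : dualPolytope (convexHull ℝ (Set.range fun i => latticePoint (q i))) =
      convexHull ℝ (Set.range fun j => latticePoint (u j)) := by
    ext y
    rw [mem_dualPolytope_convexHull_range]
    constructor
    · intro hy
      -- If `y = ∑ t j • u j` with `∑ t j = 1`, then `hqu` gives `q j ⬝ᵥ y = 1 - r * c j * t j`;
      -- solving for `t j` gives these weights.
      set t : Fin (d + 1) → ℝ := fun j => (1 / r) * ((1 / c j) * (1 - latticePoint (q j) ⬝ᵥ y))
        with ht
      have ht0 : ∀ j, 0 ≤ t j := fun j =>
        mul_nonneg (by positivity) (mul_nonneg (by positivity) (sub_nonneg.2 (hy j)))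
      have hq0 : ∑ j, (1 / (c j : ℝ)) * (latticePoint (q j) ⬝ᵥ y) = 0 := by
        have := congrArg (· ⬝ᵥ y) hsum
        simpa only [sum_dotProduct, smul_dotProduct, smul_eq_mul, zero_dotProduct] using this
      have ht1 : ∑ j, t j = 1 := by
        rw [ht, ← Finset.mul_sum]
        simp_rw [mul_sub, mul_one, Finset.sum_sub_distrib]
        rw [hq0, hr, sub_zero, one_div_mul_cancel hr0]
      have hzero : ∀ i, latticePoint (q i) ⬝ᵥ (y - ∑ j, t j • latticePoint (u j)) = 0 := fun i => by
        rw [dotProduct_sub, dotProduct_sum]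
        simp_rw [dotProduct_smul, hqu, smul_sub, Finset.sum_sub_distrib]
        rw [← Finset.sum_smul, ht1]
        simp only [smul_eq_mul, mul_ite, mul_zero, Finset.sum_ite_eq', Finset.mem_univ, if_true,
          one_mul]
        rw [ht]
        have := hc0 i
        field_simp
        ring
      have hy' : y - ∑ j, t j • latticePoint (u j) = 0 := by
        rw [← dotProduct_self_eq_zero]
        -- The difference is itself a combination of the `q i`, to all of which it is orthogonal.
        conv_lhs => arg 1; rw [← sum_coord_smul_latticePoint hqind (y - _)]
        rw [sum_dotProduct]
        simp_rw [smul_dotProduct, hzero]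
        simp
      rw [sub_eq_zero.1 hy']
      exact (convex_convexHull ℝ _).sum_mem (fun j _ => ht0 j) ht1
        fun j _ => subset_convexHull ℝ _ ⟨j, rfl⟩
    · intro hy i
      have hconv : Convex ℝ {x : Fin d → ℝ | latticePoint (q i) ⬝ᵥ x ≤ 1} := by
        intro a ha b hb s t hs ht hst
        simp only [Set.mem_ofPred_eq, dotProduct_add, dotProduct_smul, smul_eq_mul] at *
        nlinarith
      refine convexHull_min ?_ hconv hy
      rintro _ ⟨j, rfl⟩
      change latticePoint (q i) ⬝ᵥ latticePoint (u j) ≤ 1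
      rw [hqu]
      have : (0 : ℝ) ≤ if j = i then (r : ℝ) * c j else 0 := by split_ifs <;> positivity
      linarith
  refine ⟨r, by exact_mod_cast hpos, _, ⟨isLatticePolytope_convexHull_range q, ?_, ?_⟩,
    1, -z, by simp, hQ.symm⟩
  · have := (vertexBasis hqind).interior_convexHull
    refine (Set.ext_iff.1 this 0).2 fun i => ?_
    rw [congrFun hcoord0 i]
    have := hc i
    positivity
  · rw [hdual]
    exact isLatticePolytope_convexHull_range u

/-! ### An explicit simplex with prescribed group -/

/-- Vertices of a lattice simplex whose group is generated by `(1/c_0, …, 1/c_d)`. -/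
def divisorSimplexVertex {n : ℕ} (c : Fin (n + 2) → ℕ) : Fin (n + 2) → Fin (n + 1) → ℤ :=
  Fin.snoc (α := fun _ => Fin (n + 1) → ℤ) (fun i => if i = 0 then 0 else Pi.single i 1)
    fun l => if l = 0 then (c (Fin.last _) : ℤ) else -((c (Fin.last _) / c l.castSucc : ℕ) : ℤ)

theorem sum_divisorSimplexVertex_smul {n : ℕ} {M : Type*} [AddCommGroup M] (c : Fin (n + 2) → ℕ)
    (y : Fin (n + 2) → M) (l : Fin (n + 1)) :
    ∑ i, divisorSimplexVertex c i l • y i =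
      if l = 0 then c (Fin.last _) • y (Fin.last _)
      else y l.castSucc - (c (Fin.last _) / c l.castSucc) • y (Fin.last _) := by
  rw [Fin.sum_univ_castSucc]
  simp only [divisorSimplexVertex, Fin.snoc_castSucc, Fin.snoc_last]
  split_ifs with hl
  · subst hl
    rw [Finset.sum_eq_zero, zero_add, natCast_zsmul]
    intro i _
    split_ifs with hi
    · simp
    · rw [Pi.single_apply, if_neg (Ne.symm hi), zero_smul]
  · rw [Finset.sum_eq_single l, if_neg hl, Pi.single_eq_same, one_smul, neg_smul, natCast_zsmul,
      sub_eq_add_neg]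
    · intro i _ hil
      split_ifs with hi
      · simp
      · rw [Pi.single_apply, if_neg (Ne.symm hil), zero_smul]
    · simp

theorem affineIndependent_divisorSimplexVertex {n : ℕ} {c : Fin (n + 2) → ℕ}
    (hc : ∀ i, 0 < c i) :
    AffineIndependent ℝ fun i => latticePoint (divisorSimplexVertex c i) := by
  rw [affineIndependent_iff_sum_smul]
  intro w hw hwp
  have h1 : ∀ l, ∑ i, divisorSimplexVertex c i l • w i = 0 := fun l => by
    have := congrFun hwp l
    rw [Finset.sum_apply] at this
    rw [← this.trans (Pi.zero_apply l)]
    refine Finset.sum_congr rfl fun i _ => ?_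
    rw [zsmul_eq_mul, Pi.smul_apply, smul_eq_mul, mul_comm]
    rfl
  simp_rw [sum_divisorSimplexVertex_smul] at h1
  have hlast : w (Fin.last _) = 0 := by
    have h2 := h1 0
    rw [if_pos rfl, smul_eq_zero] at h2
    exact h2.resolve_left (hc _).ne'
  have hne : ∀ l : Fin (n + 1), l ≠ 0 → w l.castSucc = 0 := fun l hl => by
    have h2 := h1 l
    rwa [if_neg hl, hlast, smul_zero, sub_zero] at h2
  have hzero : w (Fin.castSucc 0) = 0 := by
    rw [Fin.sum_univ_castSucc, hlast, add_zero, Finset.sum_eq_single 0] at hw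
    · exact hw
    · exact fun l _ hl => hne l hl
    · simp
  intro i
  refine Fin.lastCases hlast (fun l => ?_) i
  by_cases hl : l = 0
  · rw [hl, hzero]
  · exact hne l hl

theorem nsmul_coe_one_div {a b v : ℕ} (hb : 0 < b) (hv : 0 < v) (h : a * b = v) :
    a • ((1 / (v : ℝ) : ℝ) : AddCircle (1 : ℝ)) = ((1 / (b : ℝ) : ℝ) : AddCircle (1 : ℝ)) := by
  rw [← AddCircle.coe_nsmul, ← h, nsmul_eq_mul]
  congr 1
  push_cast
  have ha : (a : ℝ) ≠ 0 := by
    rintro h0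
    rw [Nat.cast_eq_zero] at h0
    simp [h0] at h
    omega
  have : (b : ℝ) ≠ 0 := by exact_mod_cast hb.ne'
  field_simp

/-- Coordinate `0` of the lattice condition says that the last entry is some `a / c_last`. Each
other coordinate `l` then forces entry `l` to be `a / c_l`. Entry `0`, belonging to the vertex at
the origin, is fixed by the vanishing of the total sum. -/
theorem simplexGroup_divisorSimplexVertex {n : ℕ} {c : Fin (n + 2) → ℕ}
    (hc : ∀ i, 0 < c i) (hdvd : ∀ i, c i ∣ c (Fin.last _))
    (hsum : ∑ i, ((1 / (c i : ℝ) : ℝ) : AddCircle (1 : ℝ)) = 0) :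
    simplexGroup (divisorSimplexVertex c) =
      AddSubgroup.zmultiples fun i => ((1 / (c i : ℝ) : ℝ) : AddCircle (1 : ℝ)) := by
  have hmul : ∀ i, (c (Fin.last _) / c i) •
      ((1 / (c (Fin.last _) : ℝ) : ℝ) : AddCircle (1 : ℝ)) =
      ((1 / (c i : ℝ) : ℝ) : AddCircle (1 : ℝ)) := fun i =>
    nsmul_coe_one_div (hc i) (hc _) (Nat.div_mul_cancel (hdvd i))
  have hv : (c (Fin.last _) : ℝ) ≠ 0 := by exact_mod_cast (hc _).ne'
  apply le_antisymm
  · rintro y ⟨hy, hy'⟩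
    simp_rw [sum_divisorSimplexVertex_smul] at hy
    obtain ⟨a, ha⟩ : ∃ a : ℤ, y (Fin.last _) =
        a • ((1 / (c (Fin.last _) : ℝ) : ℝ) : AddCircle (1 : ℝ)) := by
      have h0 := hy 0
      rw [if_pos rfl, ← coe_circleFract (y (Fin.last _)), ← AddCircle.coe_nsmul,
        AddCircle.coe_eq_zero_iff] at h0
      obtain ⟨a, ha⟩ := h0
      refine ⟨a, ?_⟩
      rw [← coe_circleFract (y (Fin.last _)), ← AddCircle.coe_zsmul]
      congr 1
      rw [zsmul_eq_mul, nsmul_eq_mul, mul_one] at ha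
      rw [zsmul_eq_mul, ha]
      field_simp
    have hne : ∀ l : Fin (n + 1), l ≠ 0 →
        y l.castSucc = a • ((1 / (c l.castSucc : ℝ) : ℝ) : AddCircle (1 : ℝ)) := fun l hl => by
      have h2 := hy l
      rw [if_neg hl, sub_eq_zero, ha, smul_comm, hmul] at h2
      exact h2
    rw [AddSubgroup.mem_zmultiples_iff]
    refine ⟨a, ?_⟩
    have hzero : y (Fin.castSucc 0) =
        a • ((1 / (c (Fin.castSucc 0) : ℝ) : ℝ) : AddCircle (1 : ℝ)) := by
      have h3 : ∑ i, (y i - a • ((1 / (c i : ℝ) : ℝ) : AddCircle (1 : ℝ))) = 0 := by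
        rw [Finset.sum_sub_distrib, hy', ← Finset.smul_sum, hsum, smul_zero, sub_zero]
      rw [Fin.sum_univ_castSucc, ha, sub_self, add_zero, Finset.sum_eq_single 0] at h3
      · exact sub_eq_zero.1 h3
      · exact fun l _ hl => sub_eq_zero.2 (hne l hl)
      · simp
    ext i
    rw [Pi.smul_apply]
    refine Fin.lastCases ha.symm (fun l => ?_) i
    by_cases hl : l = 0
    · rw [hl, hzero]
    · exact (hne l hl).symm
  · rw [AddSubgroup.zmultiples_le]
    refine ⟨fun l => ?_, hsum⟩
    rw [sum_divisorSimplexVertex_smul, hmul, sub_self]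
    split_ifs
    · rw [← AddCircle.coe_nsmul, nsmul_eq_mul, mul_one_div_cancel hv]
      exact AddCircle.coe_period 1
    · rfl

/-! ### Heights as digit sums, and the multiplicities they force -/

theorem mod_eq_sum_digits {V : ℕ → ℕ} {t : ℕ} (hd : ∀ l < t, V l ∣ V (l + 1)) (h0 : V 0 = 1)
    (a : ℕ) : a % V t = ∑ l ∈ Finset.range t, (a % V (l + 1) / V l) * V l := by
  induction t with
  | zero => simp [h0, Nat.mod_one]
  | succ t ih =>
    rw [Finset.sum_range_succ, ← ih fun l hl => hd l (by omega)]
    conv_lhs => rw [← Nat.div_add_mod (a % V (t + 1)) (V t), Nat.mod_mod_of_dvd _ (hd t (by omega))]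
    ring

/-- Expanding each residue in digits and exchanging the sums: digit `l` occurs in the residues
modulo `V (i + 1)` with `i ≥ l`. In the application `s i` is the block size divided by `V (i + 1)`.
-/
theorem sum_mul_mod_eq {V : ℕ → ℕ} {t : ℕ} (hd : ∀ l < t, V l ∣ V (l + 1)) (h0 : V 0 = 1)
    (s : ℕ → ℝ) (a : ℕ) :
    ∑ i ∈ Finset.range t, s i * ((a % V (i + 1) : ℕ) : ℝ) =
      ∑ l ∈ Finset.range t, ((a % V (l + 1) / V l : ℕ) : ℝ) *
        (V l * ∑ i ∈ Finset.Ico l t, s i) := by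
  induction t with
  | zero => simp
  | succ t ih =>
    rw [Finset.sum_range_succ, ih fun l hl => hd l (by omega), mod_eq_sum_digits hd h0 a]
    push_cast
    rw [Finset.mul_sum, Finset.sum_range_succ, Finset.sum_range_succ _ t, ← add_assoc,
      ← Finset.sum_add_distrib]
    congr 1
    · refine Finset.sum_congr rfl fun l hl => ?_
      rw [Finset.mem_range] at hl
      rw [Finset.sum_Ico_succ_top hl.le]
      ring
    · rw [Nat.Ico_succ_singleton, Finset.sum_singleton]
      ring

theorem sum_mul_placeValue_mod {V : ℕ → ℕ} {t : ℕ} (hd : ∀ l < t, V l ∣ V (l + 1))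
    (hlt : ∀ l < t, V l < V (l + 1)) (s : ℕ → ℝ) {l : ℕ} (hl : l < t) :
    ∑ i ∈ Finset.range t, s i * ((V l % V (i + 1) : ℕ) : ℝ) =
      V l * ∑ i ∈ Finset.Ico l t, s i := by
  have hsub : Finset.Ico l t ⊆ Finset.range t := fun i hi =>
    Finset.mem_range.2 (Finset.mem_Ico.1 hi).2
  rw [← Finset.sum_subset hsub, Finset.mul_sum]
  · refine Finset.sum_congr rfl fun i hi => ?_
    rw [Finset.mem_Ico] at hi
    have h1 : V l ≤ V i := le_of_lt_succ hlt hi.1 hi.2.le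
    rw [Nat.mod_eq_of_lt (h1.trans_lt (hlt i hi.2)), mul_comm]
  · intro i hi hi'
    rw [Finset.mem_range] at hi
    have hil : i < l := by
      by_contra h
      exact hi' (Finset.mem_Ico.2 ⟨by omega, hi⟩)
    rw [Nat.mod_eq_zero_of_dvd (dvd_of_dvd_succ hd (by omega) hl.le)]
    simp

open Polynomial in
theorem tail_sum_mul_eq {V : ℕ → ℕ} {t K : ℕ} (hK : 0 < K)
    (hd : ∀ l < t, V l ∣ V (l + 1)) (hlt : ∀ l < t, V l < V (l + 1)) (h0 : V 0 = 1)
    {s : ℕ → ℝ} (hs : ∀ l < t, 0 < s l) {f : ℕ → ℕ}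
    (hf : ∀ a, (f a : ℝ) = ∑ i ∈ Finset.range t, s i * ((a % V (i + 1) : ℕ) : ℝ))
    (h : (∑ a ∈ Finset.range (V t), (X : ℤ[X]) ^ f a) = ∑ i ∈ Finset.range (V t), X ^ (i * K)) :
    ∀ l < t, V l * (∑ i ∈ Finset.Ico l t, s i) * V (l + 1) = K * V t := by
  have hpos : ∀ l ≤ t, 0 < V l := fun l hl => by
    have := le_of_lt_succ hlt (Nat.zero_le l) hl
    omega
  -- The weight of digit `l` is the height at the place value `V l`, which shows that it is a
  -- natural number.
  set w : ℕ → ℕ := fun l => f (V l) with hw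
  have hwl : ∀ l < t, (w l : ℝ) = V l * ∑ i ∈ Finset.Ico l t, s i := fun l hl => by
    rw [hw, hf, sum_mul_placeValue_mod hd hlt s hl]
  have hfw : ∀ a, f a = weightedDigitSum V w t a := fun a => by
    have : (f a : ℝ) = weightedDigitSum V w t a := by
      rw [hf, sum_mul_mod_eq hd h0, weightedDigitSum]
      push_cast
      refine Finset.sum_congr rfl fun l hl => ?_
      rw [hwl l (Finset.mem_range.1 hl)]
    exact_mod_cast this
  simp_rw [hfw] at h
  suffices hstep : ∀ l, l + 1 < t → w (l + 1) * V l < V (l + 1) * w l by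
    intro l hl
    rw [← hwl l hl]
    exact_mod_cast weight_mul_eq hK hd hlt h0 hstep h l hl
  intro l hl
  -- Here `w l / V l` is a tail sum of `s`, so it strictly decreases because `s l > 0`.
  have h1 : (w (l + 1) * V l : ℝ) < V (l + 1) * w l := by
    rw [hwl l (by omega), hwl (l + 1) hl, Finset.sum_eq_sum_Ico_succ_bot (by omega : l < t)]
    have e1 := hs l (by omega)
    have e2 : (0 : ℝ) < V l := by exact_mod_cast hpos l (by omega)
    have e3 : (0 : ℝ) < V (l + 1) := by exact_mod_cast hpos (l + 1) hl.le
    have : 0 < (V (l + 1) : ℝ) * V l * s l := by positivity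
    nlinarith
  exact_mod_cast h1

open Polynomial in
theorem multiplicity_unique {V : ℕ → ℕ} {t K : ℕ} (hK : 0 < K)
    (hd : ∀ l < t, V l ∣ V (l + 1)) (hlt : ∀ l < t, V l < V (l + 1)) (h0 : V 0 = 1)
    {s s' : ℕ → ℝ} (hs : ∀ l < t, 0 < s l) (hs' : ∀ l < t, 0 < s' l) {f f' : ℕ → ℕ}
    (hf : ∀ a, (f a : ℝ) = ∑ i ∈ Finset.range t, s i * ((a % V (i + 1) : ℕ) : ℝ))
    (hf' : ∀ a, (f' a : ℝ) = ∑ i ∈ Finset.range t, s' i * ((a % V (i + 1) : ℕ) : ℝ))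
    (h : (∑ a ∈ Finset.range (V t), (X : ℤ[X]) ^ f a) = ∑ i ∈ Finset.range (V t), X ^ (i * K))
    (h' : (∑ a ∈ Finset.range (V t), (X : ℤ[X]) ^ f' a) = ∑ i ∈ Finset.range (V t), X ^ (i * K)) :
    ∀ l < t, s l = s' l := by
  have h1 := tail_sum_mul_eq hK hd hlt h0 hs hf h
  have h1' := tail_sum_mul_eq hK hd hlt h0 hs' hf' h'
  have hpos : ∀ l ≤ t, (V l : ℝ) ≠ 0 := fun l hl => by
    have := le_of_lt_succ hlt (Nat.zero_le l) hl
    have : V l ≠ 0 := by omega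
    exact_mod_cast this
  have key : ∀ l ≤ t, ∑ i ∈ Finset.Ico l t, s i = ∑ i ∈ Finset.Ico l t, s' i := fun l hl => by
    rcases hl.lt_or_eq with hl | rfl
    · have := (h1 l hl).trans (h1' l hl).symm
      exact mul_left_cancel₀ (hpos l hl.le) (mul_right_cancel₀ (hpos (l + 1) hl) this)
    · simp
  intro l hl
  have := key l hl.le
  rw [Finset.sum_eq_sum_Ico_succ_bot hl, Finset.sum_eq_sum_Ico_succ_bot hl, key (l + 1) hl] at this
  exact add_right_cancel this

/-- The block sizes of the simplex belonging to a divisor chain with place values `V`. -/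
def blockSize (V : ℕ → ℕ) (t K l : ℕ) : ℕ :=
  if l + 1 < t then K * (V t / V l - V t / V (l + 2)) else K * (V t / V l)

theorem blockSize_pos {V : ℕ → ℕ} {t K : ℕ} (hK : 0 < K)
    (hd : ∀ l < t, V l ∣ V (l + 1)) (hlt : ∀ l < t, V l < V (l + 1)) (h0 : V 0 = 1)
    {l : ℕ} (hl : l < t) : 0 < blockSize V t K l := by
  have hpos : ∀ l ≤ t, 0 < V l := fun l hl => by
    have := le_of_lt_succ hlt (Nat.zero_le l) hl
    omega
  have hdt : ∀ l ≤ t, V l ∣ V t := fun l hl => dvd_of_dvd_succ hd hl le_rfl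
  unfold blockSize
  split_ifs with h
  · refine Nat.mul_pos hK (Nat.sub_pos_of_lt ?_)
    exact (Nat.div_lt_div_left (hpos t le_rfl).ne' (hdt _ h) (hdt _ hl.le)).2
      ((hlt l hl).trans (hlt (l + 1) h))
  · exact Nat.mul_pos hK (Nat.div_pos (Nat.le_of_dvd (hpos t le_rfl) (hdt l hl.le)) (hpos l hl.le))

/-- The block sizes are chosen to telescope: for `l + 1 < t`, `blockSize V t K l / V (l + 1)` is the
difference of `K * V t / (V l * V (l + 1))` and its successor, and the last term is this expression
itself. The induction runs on the length of the tail. -/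
theorem tail_sum_blockSize {V : ℕ → ℕ} {t K : ℕ}
    (hd : ∀ l < t, V l ∣ V (l + 1)) (hlt : ∀ l < t, V l < V (l + 1)) (h0 : V 0 = 1)
    {l : ℕ} (hl : l < t) :
    V l * (∑ i ∈ Finset.Ico l t, (blockSize V t K i : ℝ) / V (i + 1)) = (K * (V t / V (l + 1)) : ℕ) := by
  have hpos : ∀ l ≤ t, (V l : ℝ) ≠ 0 := fun l hl => by
    have := le_of_lt_succ hlt (Nat.zero_le l) hl
    have : V l ≠ 0 := by omega
    exact_mod_cast this
  have hdt : ∀ l ≤ t, ((V t / V l : ℕ) : ℝ) = V t / V l := fun l hl =>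
    Nat.cast_div (dvd_of_dvd_succ hd hl le_rfl) (hpos l hl)
  have hle : ∀ i j, i ≤ j → j ≤ t → V t / V j ≤ V t / V i := fun i j hij hj => by
    have h1 := le_of_lt_succ hlt (Nat.zero_le i) (hij.trans hj)
    exact Nat.div_le_div_left (le_of_lt_succ hlt hij hj) (by omega)
  obtain ⟨e, he⟩ : ∃ e, t = l + e + 1 := ⟨t - l - 1, by omega⟩
  induction e generalizing l with
  | zero =>
    have e1 := hpos l hl.le
    have e2 := hpos (l + 1) hl
    obtain rfl : t = l + 1 := by omega
    rw [Finset.sum_eq_sum_Ico_succ_bot hl, Finset.Ico_self, Finset.sum_empty,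
      blockSize, if_neg (by omega), add_zero]
    push_cast
    rw [hdt l hl.le, hdt (l + 1) hl]
    field_simp
  | succ e ih =>
    have h1 := ih (l := l + 1) (by omega) (by omega)
    have e1 := hpos l hl.le
    have e2 := hpos (l + 1) hl
    have e3 := hpos (l + 2) (by omega)
    rw [Finset.sum_eq_sum_Ico_succ_bot hl, blockSize, if_pos (by omega)]
    have h2 : ∑ i ∈ Finset.Ico (l + 1) t, (blockSize V t K i : ℝ) / V (i + 1) =
        (K * (V t / V (l + 2)) : ℕ) / V (l + 1) := by
      rw [← h1]
      field_simp
    rw [h2]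
    push_cast [Nat.cast_sub (hle l (l + 2) (by omega) (by omega))]
    rw [hdt l hl.le, hdt (l + 1) hl, hdt (l + 2) (by omega)]
    field_simp
    ring

theorem cast_weightedDigitSum_blockSize {V : ℕ → ℕ} {t K : ℕ}
    (hd : ∀ l < t, V l ∣ V (l + 1)) (hlt : ∀ l < t, V l < V (l + 1)) (h0 : V 0 = 1) (a : ℕ) :
    (weightedDigitSum V (fun l => K * (V t / V (l + 1))) t a : ℝ) =
      ∑ i ∈ Finset.range t, (blockSize V t K i : ℝ) / V (i + 1) * ((a % V (i + 1) : ℕ) : ℝ) := by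
  rw [sum_mul_mod_eq hd h0, weightedDigitSum]
  push_cast
  refine Finset.sum_congr rfl fun l hl => ?_
  rw [tail_sum_blockSize hd hlt h0 (Finset.mem_range.1 hl)]
  push_cast
  rfl

/-! ### Divisor sequences and block vectors -/

/-- The sequence `1, c 0, c 1, …`, as place values of a mixed radix system. -/
def placeValue {m : ℕ} (c : Fin (m + 1) → ℕ) : ℕ → ℕ
  | 0 => 1
  | i + 1 => if h : i < m + 1 then c ⟨i, h⟩ else 0

/-- `1 < c 0 < ⋯ < c m = v`, and each term divides the next one. -/
def IsDivisorSequence (v : ℕ) {m : ℕ} (c : Fin (m + 1) → ℕ) : Prop :=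
  1 < c 0 ∧ StrictMono c ∧ (∀ i : Fin m, c i.castSucc ∣ c i.succ) ∧ c (Fin.last m) = v

theorem placeValue_succ {m : ℕ} (c : Fin (m + 1) → ℕ) (i : Fin (m + 1)) :
    placeValue c (i + 1) = c i := by
  rw [placeValue, dif_pos i.2]

namespace IsDivisorSequence

variable {v m : ℕ} {c : Fin (m + 1) → ℕ}

theorem placeValue_last (h : IsDivisorSequence v c) : placeValue c (m + 1) = v :=
  (placeValue_succ c (Fin.last m)).trans h.2.2.2

theorem placeValue_dvd (h : IsDivisorSequence v c) :
    ∀ l < m + 1, placeValue c l ∣ placeValue c (l + 1) := by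
  rintro (_ | l) hl
  · exact one_dvd _
  · have h1 := placeValue_succ c (Fin.castSucc ⟨l, by omega⟩)
    have h2 := placeValue_succ c (Fin.succ ⟨l, by omega⟩)
    have h3 := h.2.2.1 ⟨l, by omega⟩
    rw [← h1, ← h2] at h3
    exact h3

theorem placeValue_lt (h : IsDivisorSequence v c) :
    ∀ l < m + 1, placeValue c l < placeValue c (l + 1) := by
  rintro (_ | l) hl
  · exact (placeValue_succ c 0).symm ▸ h.1
  · have h1 := placeValue_succ c (Fin.castSucc ⟨l, by omega⟩)
    have h2 := placeValue_succ c (Fin.succ ⟨l, by omega⟩)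
    have h3 := h.2.1 (Fin.castSucc_lt_succ (i := ⟨l, by omega⟩))
    rw [← h1, ← h2] at h3
    exact h3

theorem one_lt (h : IsDivisorSequence v c) (i : Fin (m + 1)) : 1 < c i :=
  h.1.trans_le (h.2.1.monotone (Fin.zero_le i))

theorem dvd_of_le (h : IsDivisorSequence v c) {i j : Fin (m + 1)} (hij : i ≤ j) : c i ∣ c j := by
  rw [← placeValue_succ c i, ← placeValue_succ c j]
  exact dvd_of_dvd_succ h.placeValue_dvd (by simpa using hij) (by omega)

end IsDivisorSequence

/-- The number of coordinates in a block. -/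
def fiberCard {d m : ℕ} (b : Fin (d + 1) → Fin (m + 1)) (i : ℕ) : ℕ :=
  (Finset.univ.filter fun j => (b j : ℕ) = i).card

theorem sum_comp_block {d m : ℕ} (b : Fin (d + 1) → Fin (m + 1)) (F : ℕ → ℝ) :
    ∑ j, F (b j) = ∑ i ∈ Finset.range (m + 1), fiberCard b i * F i := by
  rw [← Finset.sum_fiberwise_of_maps_to (s := Finset.univ) (t := Finset.range (m + 1))
    (g := fun j => (b j : ℕ)) (fun j _ => Finset.mem_range.2 (b j).2)]
  refine Finset.sum_congr rfl fun i _ => ?_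
  rw [Finset.sum_congr rfl (g := fun _ => F i) fun j hj => by rw [(Finset.mem_filter.1 hj).2],
    Finset.sum_const, nsmul_eq_mul]
  rfl

/-- The vector with coordinates `1/c (b j)`. -/
noncomputable def blockVector {d m : ℕ} (c : Fin (m + 1) → ℕ) (b : Fin (d + 1) → Fin (m + 1)) :
    Fin (d + 1) → AddCircle (1 : ℝ) :=
  fun j => ((1 / (c (b j) : ℝ) : ℝ) : AddCircle (1 : ℝ))

theorem nsmul_blockVector_apply {d m : ℕ} (c : Fin (m + 1) → ℕ) (b : Fin (d + 1) → Fin (m + 1))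
    (a : ℕ) (j : Fin (d + 1)) :
    (a • blockVector c b) j = (((a : ℝ) / (c (b j) : ℝ) : ℝ) : AddCircle (1 : ℝ)) := by
  rw [Pi.smul_apply, blockVector, ← AddCircle.coe_nsmul, nsmul_eq_mul, mul_one_div]

theorem sum_circleFract_nsmul_blockVector {d m : ℕ} (c : Fin (m + 1) → ℕ)
    (b : Fin (d + 1) → Fin (m + 1)) (a : ℕ) :
    ∑ j, circleFract ((a • blockVector c b) j) =
      ∑ i ∈ Finset.range (m + 1), (fiberCard b i : ℝ) / placeValue c (i + 1) *
        ((a % placeValue c (i + 1) : ℕ) : ℝ) := by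
  have h1 : ∀ j, circleFract ((a • blockVector c b) j) =
      (fun i => ((a % placeValue c (i + 1) : ℕ) : ℝ) / placeValue c (i + 1)) (b j : ℕ) := fun j => by
    rw [nsmul_blockVector_apply, circleFract_coe]
    dsimp only
    rw [placeValue_succ, Int.fract_div_natCast_eq_div_natCast_mod]
  simp_rw [h1]
  rw [sum_comp_block b fun i => ((a % placeValue c (i + 1) : ℕ) : ℝ) / placeValue c (i + 1)]
  refine Finset.sum_congr rfl fun i _ => ?_
  ring

theorem addOrderOf_one_div {n : ℕ} (hn : 0 < n) :
    addOrderOf ((1 / (n : ℝ) : ℝ) : AddCircle (1 : ℝ)) = n :=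
  AddCircle.addOrderOf_period_div hn

theorem nsmul_blockVector_apply_eq_zero_iff {d m v : ℕ} {c : Fin (m + 1) → ℕ}
    (hc : IsDivisorSequence v c) (b : Fin (d + 1) → Fin (m + 1)) (a : ℕ) (j : Fin (d + 1)) :
    a • blockVector c b j = 0 ↔ c (b j) ∣ a := by
  rw [← addOrderOf_dvd_iff_nsmul_eq_zero, blockVector,
    addOrderOf_one_div (zero_lt_one.trans (hc.one_lt _))]

theorem addOrderOf_blockVector {d m v : ℕ} {c : Fin (m + 1) → ℕ}
    (hc : IsDivisorSequence v c) {b : Fin (d + 1) → Fin (m + 1)} (hb : Function.Surjective b) :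
    addOrderOf (blockVector c b) = v := by
  refine Nat.dvd_antisymm (addOrderOf_dvd_of_nsmul_eq_zero ?_) ?_
  · ext j
    refine (nsmul_blockVector_apply_eq_zero_iff hc b v j).2 ?_
    conv_rhs => rw [← hc.2.2.2]
    exact hc.dvd_of_le (Fin.le_last _)
  · obtain ⟨j, hj⟩ := hb (Fin.last m)
    have := (nsmul_blockVector_apply_eq_zero_iff hc b (addOrderOf (blockVector c b)) j).1
      (congrFun (addOrderOf_nsmul_eq_zero (blockVector c b)) j)
    rwa [hj, hc.2.2.2] at this

theorem isDeltaPolynomial_iff_of_blockVector {d m v : ℕ} {p : Fin (d + 1) → Fin d → ℤ}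
    (h : AffineIndependent ℝ (fun i => latticePoint (p i))) {c : Fin (m + 1) → ℕ}
    (hc : IsDivisorSequence v c) {b : Fin (d + 1) → Fin (m + 1)} (hb : Function.Surjective b)
    (hG : simplexGroup p = AddSubgroup.zmultiples (blockVector c b)) (f : Polynomial ℤ) :
    IsDeltaPolynomial (convexHull ℝ (Set.range fun i => latticePoint (p i))) f ↔
      ∑ a ∈ Finset.range v, Polynomial.X ^ groupHeight (a • blockVector c b) = f := by
  classical
  have hord := addOrderOf_blockVector hc hb
  have hvpos : 0 < v := by
    have := hc.one_lt (Fin.last m)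
    rw [hc.2.2.2] at this
    omega
  have hfin : IsOfFinAddOrder (blockVector c b) := by
    rw [← addOrderOf_pos_iff, hord]
    exact hvpos
  rw [isDeltaPolynomial_convexHull_iff h
    (G := (Finset.range v).image fun a => a • blockVector c b), Finset.sum_image]
  · intro a ha a' ha' haa
    have ha : a ∈ Finset.range v := ha
    have ha' : a' ∈ Finset.range v := ha'
    rw [Finset.mem_range] at ha ha'
    exact nsmul_injOn_Iio_addOrderOf (by rw [hord]; exact ha) (by rw [hord]; exact ha') haa
  · intro y
    rw [hG, hfin.mem_zmultiples_iff_mem_range_addOrderOf, hord]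

theorem cast_groupHeight_nsmul_blockVector {d m : ℕ} {p : Fin (d + 1) → Fin d → ℤ}
    {c : Fin (m + 1) → ℕ} {b : Fin (d + 1) → Fin (m + 1)}
    (hG : simplexGroup p = AddSubgroup.zmultiples (blockVector c b)) (a : ℕ) :
    (groupHeight (a • blockVector c b) : ℝ) =
      ∑ i ∈ Finset.range (m + 1), (fiberCard b i : ℝ) / placeValue c (i + 1) *
        ((a % placeValue c (i + 1) : ℕ) : ℝ) := by
  rw [cast_groupHeight (p := p), sum_circleFract_nsmul_blockVector]
  rw [hG]
  exact AddSubgroup.nsmul_mem_zmultiples _ _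

/-- Any enumeration of the disjoint union of the blocks, sorted by block index, is monotone. -/
theorem exists_monotone_fiberCard {d m : ℕ} (s : Fin (m + 1) → ℕ) (hs : ∑ i, s i = d + 1) :
    ∃ b : Fin (d + 1) → Fin (m + 1), Monotone b ∧ ∀ i : Fin (m + 1), fiberCard b i = s i := by
  let E₀ : (Σ i, Fin (s i)) ≃ Fin (d + 1) := finSigmaFinEquiv.trans (finCongr hs)
  let E : (Σ i, Fin (s i)) ≃ Fin (d + 1) :=
    E₀.trans (Tuple.sort fun j => (E₀.symm j).1).symm
  refine ⟨fun j => (E.symm j).1, Tuple.monotone_sort fun j => (E₀.symm j).1, fun i => ?_⟩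
  have h1 : (Finset.univ.filter fun j => (((E.symm j).1 : Fin (m + 1)) : ℕ) = i) =
      Finset.univ.image fun k : Fin (s i) => E ⟨i, k⟩ := by
    ext j
    simp only [Finset.mem_filter, Finset.mem_univ, true_and, Finset.mem_image, Fin.val_inj]
    constructor
    · rintro rfl
      exact ⟨(E.symm j).2, E.apply_symm_apply j⟩
    · rintro ⟨k, rfl⟩
      simp
  rw [fiberCard, h1, Finset.card_image_of_injective, Finset.card_univ, Fintype.card_fin]
  intro k k' hk
  simpa using hk

/-- Equal fibre sizes make the two maps rearrangements of each other, and a monotone rearrangement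
is unique. -/
theorem eq_of_monotone_of_fiberCard_eq {d m : ℕ} {b b' : Fin (d + 1) → Fin (m + 1)}
    (hb : Monotone b) (hb' : Monotone b') (h : ∀ i : Fin (m + 1), fiberCard b i = fiberCard b' i) :
    b = b' := by
  have he : ∀ i, Nonempty ({j // b' j = i} ≃ {j // b j = i}) := fun i => by
    refine ⟨Fintype.equivOfCardEq ?_⟩
    rw [Fintype.card_subtype, Fintype.card_subtype]
    have := h i
    simp only [fiberCard, Fin.val_inj] at this
    exact this.symm
  let E : Equiv.Perm (Fin (d + 1)) := (Equiv.sigmaFiberEquiv b').symm.trans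
    ((Equiv.sigmaCongrRight fun i => (he i).some).trans (Equiv.sigmaFiberEquiv b))
  have hE : b ∘ E = b' := by
    ext1 j
    exact ((he (b' j)).some ⟨j, rfl⟩).2
  have := Tuple.unique_monotone (f := b) (σ := Equiv.refl _) (τ := E) hb (by rw [hE]; exact hb')
  rw [← hE, ← this]
  rfl

/-! ### Chains of divisors as divisor sequences -/

theorem dvd_of_isChain_of_le {C : Finset ℕ} (hC : IsChain (· ∣ ·) (C : Set ℕ))
    (h0 : ∀ a ∈ C, 0 < a) {a b : ℕ} (ha : a ∈ C) (hb : b ∈ C) (hab : a ≤ b) : a ∣ b := by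
  by_cases h : a = b
  · rw [h]
  · rcases hC ha hb h with h1 | h1
    · exact h1
    · exact absurd (le_antisymm hab (Nat.le_of_dvd (h0 a ha) h1)) h

theorem mem_divisorChains_iff {v : ℕ} {C : Finset ℕ} :
    C ∈ divisorChains v ↔
      C ⊆ v.divisors ∧ IsChain (· ∣ ·) (C : Set ℕ) ∧ v ∈ C ∧ 1 ∉ C := by
  refine and_congr_right fun h1 => and_congr_right fun h2 => and_congr_right fun h3 => ?_
  have h0 : ∀ a ∈ C, 0 < a := fun a ha => Nat.pos_of_mem_divisors (h1 ha)
  constructor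
  · rintro ⟨a, -, ha1, hdvd⟩ hmem
    exact ha1 (Nat.dvd_one.1 (hdvd 1 hmem))
  · intro hmem
    refine ⟨C.min' ⟨v, h3⟩, C.min'_mem _, fun h => hmem (h ▸ C.min'_mem _), fun b hb => ?_⟩
    exact dvd_of_isChain_of_le h2 h0 (C.min'_mem _) hb (C.min'_le b hb)

theorem image_mem_divisorChains {v m : ℕ} {c : Fin (m + 1) → ℕ} (hc : IsDivisorSequence v c) :
    Finset.univ.image c ∈ divisorChains v := by
  have hv : 1 < v := by
    have := hc.one_lt (Fin.last m)
    rwa [hc.2.2.2] at this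
  rw [mem_divisorChains_iff]
  refine ⟨fun a ha => ?_, fun a ha b hb _ => ?_, ?_, ?_⟩
  · obtain ⟨i, -, rfl⟩ := Finset.mem_image.1 ha
    refine Nat.mem_divisors.2 ⟨?_, by omega⟩
    have := hc.dvd_of_le (Fin.le_last i)
    rwa [hc.2.2.2] at this
  · obtain ⟨i, -, rfl⟩ := Finset.mem_image.1 (Finset.mem_coe.1 ha)
    obtain ⟨j, -, rfl⟩ := Finset.mem_image.1 (Finset.mem_coe.1 hb)
    exact (le_total i j).imp hc.dvd_of_le hc.dvd_of_le
  · exact Finset.mem_image.2 ⟨Fin.last m, Finset.mem_univ _, hc.2.2.2⟩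
  · intro h
    obtain ⟨i, -, hi⟩ := Finset.mem_image.1 h
    have := hc.one_lt i
    omega

theorem exists_isDivisorSequence {v : ℕ} {C : Finset ℕ} (hC : C ∈ divisorChains v) :
    ∃ (m : ℕ) (c : Fin (m + 1) → ℕ), IsDivisorSequence v c ∧ Finset.univ.image c = C := by
  rw [mem_divisorChains_iff] at hC
  obtain ⟨h1, h2, h3, h4⟩ := hC
  have h0 : ∀ a ∈ C, 0 < a := fun a ha => Nat.pos_of_mem_divisors (h1 ha)
  obtain ⟨m, hm⟩ : ∃ m, C.card = m + 1 :=
    ⟨C.card - 1, by have := Finset.card_pos.2 ⟨v, h3⟩; omega⟩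
  have himage : Finset.univ.image (C.orderEmbOfFin hm) = C := C.image_orderEmbOfFin_univ hm
  have hmem : ∀ i, C.orderEmbOfFin hm i ∈ C := C.orderEmbOfFin_mem hm
  refine ⟨m, C.orderEmbOfFin hm, ⟨?_, (C.orderEmbOfFin hm).strictMono, fun i => ?_, ?_⟩, himage⟩
  · have e1 := h0 _ (hmem 0)
    have e2 : C.orderEmbOfFin hm 0 ≠ 1 := fun h => h4 (h ▸ hmem 0)
    omega
  · exact dvd_of_isChain_of_le h2 h0 (hmem _) (hmem _)
      ((C.orderEmbOfFin hm).monotone (Fin.castSucc_lt_succ (i := i)).le)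
  · refine le_antisymm (Nat.divisor_le (h1 (hmem _))) ?_
    rw [← himage] at h3
    obtain ⟨i, -, rfl⟩ := Finset.mem_image.1 h3
    exact (C.orderEmbOfFin hm).monotone (Fin.le_last i)

/-! ### Classification of the simplices by their chains -/

/-- The data of a simplex whose group is generated by the block vector of a divisor sequence, and
whose `δ`-polynomial is `1 + t^(k+1) + ⋯ + t^((v-1)(k+1))`. -/
structure IsBlockSimplex (v k : ℕ) {d m : ℕ} (P : Set (Fin d → ℝ))
    (p : Fin (d + 1) → Fin d → ℤ) (c : Fin (m + 1) → ℕ) (b : Fin (d + 1) → Fin (m + 1)) :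
    Prop where
  ordering : IsVertexOrdering P p
  seq : IsDivisorSequence v c
  mono : Monotone b
  surj : Function.Surjective b
  group : simplexGroup p = AddSubgroup.zmultiples (blockVector c b)
  delta : IsDeltaPolynomial P (∑ i ∈ Finset.range v, Polynomial.X ^ (i * (k + 1)))

theorem isDivisorChainSimplex_iff {v k d : ℕ} {P : Set (Fin d → ℝ)} :
    IsDivisorChainSimplex v k P ↔
      ∃ (m : ℕ) (p : Fin (d + 1) → Fin d → ℤ) (c : Fin (m + 1) → ℕ)
        (b : Fin (d + 1) → Fin (m + 1)), IsBlockSimplex v k P p c b := by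
  constructor
  · rintro ⟨-, ⟨p, hp, x, ⟨m, c, b, h1, h2, h3, h4, h5, h6, h7⟩, hG⟩, hδ⟩
    obtain rfl : x = blockVector c b := funext h7
    exact ⟨m, p, c, b, hp, ⟨h1, h2, h3, h4⟩, h5, h6, hG, hδ⟩
  · rintro ⟨m, p, c, b, hp, hc, h5, h6, hG, hδ⟩
    refine ⟨?_, ⟨p, hp, blockVector c b, ⟨m, c, b, hc.1, hc.2.1, hc.2.2.1, hc.2.2.2, h5, h6,
      fun _ => rfl⟩, hG⟩, hδ⟩
    rw [hp.2]
    exact isGorenstein_of_simplexGroup_eq hp.1 (c := fun j => c (b j))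
      (fun j => zero_lt_one.trans (hc.one_lt _)) hG

namespace IsBlockSimplex

variable {v k d m m' : ℕ} {P P' : Set (Fin d → ℝ)} {p p' : Fin (d + 1) → Fin d → ℤ}
  {c : Fin (m + 1) → ℕ} {c' : Fin (m' + 1) → ℕ} {b : Fin (d + 1) → Fin (m + 1)}
  {b' : Fin (d + 1) → Fin (m' + 1)}

/-- The permuted vector is a multiple of the generator, so its `j`-th entry, of order `c' (b' (σ
j))`, is killed by `c (b j)`. Applied in both directions, this makes the values agree. -/
theorem dvd_of_mem_simplexGroup (h : IsBlockSimplex v k P p c b) (h' : IsBlockSimplex v k P' p' c' b')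
    {σ : Equiv.Perm (Fin (d + 1))} (hσ : blockVector c' b' ∘ σ ∈ simplexGroup p)
    (j : Fin (d + 1)) : c' (b' (σ j)) ∣ c (b j) := by
  rw [h.group, AddSubgroup.mem_zmultiples_iff] at hσ
  obtain ⟨n, hn⟩ := hσ
  rw [← nsmul_blockVector_apply_eq_zero_iff h'.seq]
  have h1 := congrFun hn j
  rw [Function.comp_apply] at h1
  rw [← h1, Pi.smul_apply, smul_comm,
    (nsmul_blockVector_apply_eq_zero_iff h.seq b _ j).2 dvd_rfl, smul_zero]

theorem image_eq_of_unimodularlyEquivalent (h : IsBlockSimplex v k P p c b)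
    (h' : IsBlockSimplex v k P' p' c' b') (hPP' : UnimodularlyEquivalent P P') :
    Finset.univ.image c = Finset.univ.image c' := by
  obtain ⟨σ, hσ⟩ := exists_perm_of_unimodularlyEquivalent h.ordering h'.ordering hPP'
  have h1 : ∀ j, c' (b' (σ j)) ∣ c (b j) := dvd_of_mem_simplexGroup h h' <| by
    rw [hσ, h'.group]
    exact AddSubgroup.mem_zmultiples _
  have h2 : ∀ j, c (b (σ.symm j)) ∣ c' (b' j) := dvd_of_mem_simplexGroup h' h <| by
    rw [← hσ, h.group, Function.comp_assoc, Equiv.symm_comp_self, Function.comp_id]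
    exact AddSubgroup.mem_zmultiples _
  have h3 : c ∘ b = c' ∘ b' ∘ σ := by
    ext j
    refine Nat.dvd_antisymm ?_ (h1 j)
    have := h2 (σ j)
    rwa [Equiv.symm_apply_apply] at this
  have h4 := congrArg Set.range h3
  rw [h.surj.range_comp, (h'.surj.comp σ.surjective).range_comp] at h4
  rw [← Finset.coe_inj, Finset.coe_image, Finset.coe_image, Finset.coe_univ, Finset.coe_univ,
    Set.image_univ, Set.image_univ, h4]

theorem fiberCard_pos (h : IsBlockSimplex v k P p c b) {l : ℕ} (hl : l < m + 1) :
    0 < fiberCard b l := by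
  obtain ⟨j, hj⟩ := h.surj ⟨l, hl⟩
  exact Finset.card_pos.2 ⟨j, by simp [hj]⟩

end IsBlockSimplex

theorem fiberCard_eq_of_isBlockSimplex {v k d d' m : ℕ} {P : Set (Fin d → ℝ)}
    {P' : Set (Fin d' → ℝ)} {p : Fin (d + 1) → Fin d → ℤ} {p' : Fin (d' + 1) → Fin d' → ℤ}
    {c : Fin (m + 1) → ℕ} {b : Fin (d + 1) → Fin (m + 1)} {b' : Fin (d' + 1) → Fin (m + 1)}
    (h : IsBlockSimplex v k P p c b) (h' : IsBlockSimplex v k P' p' c b') :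
    ∀ l < m + 1, fiberCard b l = fiberCard b' l := by
  have hV0 : ∀ l < m + 1, (0 : ℝ) < placeValue c (l + 1) := fun l hl => by
    have := h.seq.placeValue_lt l hl
    exact_mod_cast (Nat.zero_le _).trans_lt this
  have hδ : ∀ {e : ℕ} {Q : Set (Fin e → ℝ)} {q : Fin (e + 1) → Fin e → ℤ}
      {β : Fin (e + 1) → Fin (m + 1)}, IsBlockSimplex v k Q q c β →
      (∑ a ∈ Finset.range (placeValue c (m + 1)),
        (Polynomial.X : Polynomial ℤ) ^ groupHeight (a • blockVector c β)) =
        ∑ i ∈ Finset.range (placeValue c (m + 1)), Polynomial.X ^ (i * (k + 1)) := by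
    intro e Q q β hQ
    have h1 := hQ.delta
    rw [hQ.ordering.2] at h1
    rw [h.seq.placeValue_last]
    exact (isDeltaPolynomial_iff_of_blockVector hQ.ordering.1 hQ.seq hQ.surj hQ.group _).1 h1
  have key := multiplicity_unique (Nat.succ_pos k) h.seq.placeValue_dvd h.seq.placeValue_lt rfl
    (s := fun i => (fiberCard b i : ℝ) / placeValue c (i + 1))
    (s' := fun i => (fiberCard b' i : ℝ) / placeValue c (i + 1))
    (fun l hl => div_pos (by exact_mod_cast h.fiberCard_pos hl) (hV0 l hl))
    (fun l hl => div_pos (by exact_mod_cast h'.fiberCard_pos hl) (hV0 l hl))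
    (cast_groupHeight_nsmul_blockVector h.group) (cast_groupHeight_nsmul_blockVector h'.group)
    (hδ h) (hδ h')
  intro l hl
  exact_mod_cast (div_left_inj' (hV0 l hl).ne').1 (key l hl)

theorem card_eq_sum_fiberCard {d m : ℕ} (b : Fin (d + 1) → Fin (m + 1)) :
    d + 1 = ∑ i ∈ Finset.range (m + 1), fiberCard b i := by
  have := sum_comp_block b fun _ => 1
  simp only [Finset.sum_const, Finset.card_univ, Fintype.card_fin, nsmul_eq_mul, mul_one] at this
  exact_mod_cast this

/-- The chain determines its increasing enumeration, hence the block sizes, hence the dimension and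
the block map, hence the generator of the group. -/
theorem class_eq_of_image_eq {v k d d' m m' : ℕ} {P : Set (Fin d → ℝ)} {P' : Set (Fin d' → ℝ)}
    {p : Fin (d + 1) → Fin d → ℤ} {p' : Fin (d' + 1) → Fin d' → ℤ} {c : Fin (m + 1) → ℕ}
    {c' : Fin (m' + 1) → ℕ} {b : Fin (d + 1) → Fin (m + 1)} {b' : Fin (d' + 1) → Fin (m' + 1)}
    (h : IsBlockSimplex v k P p c b) (h' : IsBlockSimplex v k P' p' c' b')
    (hcc' : Finset.univ.image c = Finset.univ.image c') :
    (⟨d, Quotient.mk (unimodularSetoid d) P⟩ : Σ d : ℕ, Quotient (unimodularSetoid d)) =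
      ⟨d', Quotient.mk (unimodularSetoid d') P'⟩ := by
  have hcard : ∀ {n : ℕ} {e : Fin (n + 1) → ℕ}, StrictMono e →
      (Finset.univ.image e).card = n + 1 := fun he => by
    rw [Finset.card_image_of_injective _ he.injective, Finset.card_univ, Fintype.card_fin]
  obtain rfl : m = m' := by
    have h1 := hcard h.seq.2.1
    rw [hcc', hcard h'.seq.2.1] at h1
    omega
  obtain rfl : c = c' := by
    have h1 := hcard h.seq.2.1
    rw [Finset.orderEmbOfFin_unique h1 (f := c) (by simp) h.seq.2.1]
    rw [Finset.orderEmbOfFin_unique h1 (f := c') (by simp [hcc']) h'.seq.2.1]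
  have hfib := fiberCard_eq_of_isBlockSimplex h h'
  obtain rfl : d = d' := by
    have h1 := card_eq_sum_fiberCard b
    rw [Finset.sum_congr rfl fun l hl => hfib l (Finset.mem_range.1 hl),
      ← card_eq_sum_fiberCard b'] at h1
    omega
  obtain rfl : b = b' := eq_of_monotone_of_fiberCard_eq h.mono h'.mono fun i => hfib i i.2
  congr 1
  refine Quotient.sound ?_
  change UnimodularlyEquivalent P P'
  rw [h.ordering.2, h'.ordering.2]
  exact unimodularlyEquivalent_of_simplexGroup_eq h.ordering.1 h'.ordering.1
    (h.group.trans h'.group.symm)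

/-- Every divisor sequence comes from a simplex. -/
theorem exists_isBlockSimplex {v m : ℕ} (k : ℕ) {c : Fin (m + 1) → ℕ}
    (hc : IsDivisorSequence v c) :
    ∃ (d : ℕ) (P : Set (Fin d → ℝ)) (p : Fin (d + 1) → Fin d → ℤ)
      (b : Fin (d + 1) → Fin (m + 1)), IsBlockSimplex v k P p c b := by
  set V := placeValue c
  have hd : ∀ l < m + 1, V l ∣ V (l + 1) := hc.placeValue_dvd
  have hlt : ∀ l < m + 1, V l < V (l + 1) := hc.placeValue_lt
  have hVt : V (m + 1) = v := hc.placeValue_last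
  set s : ℕ → ℕ := blockSize V (m + 1) (k + 1) with hs
  have hspos : ∀ l < m + 1, 0 < s l := fun l hl => blockSize_pos (Nat.succ_pos k) hd hlt rfl hl
  -- The last block alone has at least two coordinates, so the dimension is positive, as the
  -- explicit simplex requires.
  have hslast : 2 ≤ s m := by
    rw [hs, blockSize, if_neg (by omega)]
    obtain ⟨g, hg⟩ := hd m (by omega)
    have h1 := hlt m (by omega)
    have h2 : 0 < V m := by
      have := le_of_lt_succ hlt (Nat.zero_le m) (by omega)
      exact Nat.lt_of_lt_of_le zero_lt_one this
    have h3 : 2 ≤ g := by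
      by_contra! h4
      have : V m * g ≤ V m * 1 := Nat.mul_le_mul_left _ (by omega)
      rw [← hg] at this
      omega
    rw [hg, Nat.mul_div_cancel_left _ h2]
    nlinarith
  obtain ⟨n, hn⟩ : ∃ n, ∑ i : Fin (m + 1), s i = n + 1 + 1 := by
    have h1 := Finset.single_le_sum (f := fun i : Fin (m + 1) => s i)
      (fun _ _ => Nat.zero_le _) (Finset.mem_univ (Fin.last m))
    simp only [Fin.val_last] at h1
    exact ⟨∑ i : Fin (m + 1), s i - 2, by omega⟩
  obtain ⟨b, hb, hbs⟩ := exists_monotone_fiberCard (fun i : Fin (m + 1) => s i) hn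
  have hsurj : Function.Surjective b := fun i => by
    have h1 := hspos i i.2
    rw [← hbs i, fiberCard, Finset.card_pos] at h1
    obtain ⟨j, hj⟩ := h1
    exact ⟨j, Fin.ext (Finset.mem_filter.1 hj).2⟩
  have hpos : ∀ j, 0 < c (b j) := fun j => zero_lt_one.trans (hc.one_lt _)
  have hblast : c (b (Fin.last _)) = v := by
    obtain ⟨j, hj⟩ := hsurj (Fin.last m)
    have : b (Fin.last _) = Fin.last m := le_antisymm (Fin.le_last _) (hj ▸ hb (Fin.le_last j))
    rw [this, hc.2.2.2]
  have hheight : ∀ a, ∑ j, circleFract ((a • blockVector c b) j) =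
      weightedDigitSum V (fun l => (k + 1) * (V (m + 1) / V (l + 1))) (m + 1) a := fun a => by
    rw [sum_circleFract_nsmul_blockVector, cast_weightedDigitSum_blockSize hd hlt rfl]
    refine Finset.sum_congr rfl fun i hi => ?_
    have := hbs ⟨i, Finset.mem_range.1 hi⟩
    simp only at this
    rw [this]
  -- The fractional parts of the generator (`a = 1`) add up to a digit sum, which is an integer.
  have hsum : ∑ j, ((1 / (c (b j) : ℝ) : ℝ) : AddCircle (1 : ℝ)) = 0 := by
    have h1 := hheight 1
    have h2 := congrArg (fun r : ℝ => (r : AddCircle (1 : ℝ))) h1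
    rw [← QuotientAddGroup.mk'_apply, map_sum] at h2
    simp only [QuotientAddGroup.mk'_apply, coe_circleFract, one_smul] at h2
    exact h2.trans ((AddCircle.coe_eq_zero_iff 1).2 ⟨_, by rw [zsmul_one, Int.cast_natCast]⟩)
  have haff := affineIndependent_divisorSimplexVertex (c := fun j => c (b j)) hpos
  have hG : simplexGroup (divisorSimplexVertex fun j => c (b j)) =
      AddSubgroup.zmultiples (blockVector c b) :=
    simplexGroup_divisorSimplexVertex hpos
      (fun j => hc.dvd_of_le (hb (Fin.le_last j))) hsum
  refine ⟨n + 1, _, divisorSimplexVertex fun j => c (b j), b, ⟨haff, rfl⟩, hc, hb, hsurj, hG, ?_⟩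
  rw [isDeltaPolynomial_iff_of_blockVector haff hc hsurj hG, ← hVt]
  have hh : ∀ a, groupHeight (a • blockVector c b) =
      weightedDigitSum V (fun l => (k + 1) * (V (m + 1) / V (l + 1))) (m + 1) a := fun a => by
    rw [groupHeight, hheight, Nat.floor_natCast]
  simp_rw [hh]
  refine sum_X_pow_weightedDigitSum (k + 1) hd hlt rfl fun l hl => ?_
  rw [mul_assoc, Nat.div_mul_cancel (dvd_of_dvd_succ hd (i := l + 1) hl le_rfl)]

/-! ### Counting classes by chains, and the recursion -/

theorem ncard_divisorChainClasses (v k : ℕ) :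
    (divisorChainClasses v k).ncard = (divisorChains v).ncard := by
  have hex : ∀ C ∈ divisorChains v, ∃ (d : ℕ) (P : Set (Fin d → ℝ)) (m : ℕ)
      (p : Fin (d + 1) → Fin d → ℤ) (c : Fin (m + 1) → ℕ) (b : Fin (d + 1) → Fin (m + 1)),
      IsBlockSimplex v k P p c b ∧ Finset.univ.image c = C := fun C hC => by
    obtain ⟨m, c, hc, hcC⟩ := exists_isDivisorSequence hC
    obtain ⟨d, P, p, b, h⟩ := exists_isBlockSimplex k hc
    exact ⟨d, P, m, p, c, b, h, hcC⟩
  choose! d P hP using hex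
  symm
  refine Set.ncard_congr (fun C _ => ⟨d C, Quotient.mk (unimodularSetoid (d C)) (P C)⟩) ?_ ?_ ?_
  · intro C hC
    obtain ⟨m, p, c, b, h, -⟩ := hP C hC
    exact ⟨d C, P C, isDivisorChainSimplex_iff.2 ⟨m, p, c, b, h⟩, rfl⟩
  · intro C C' hC hC' heq
    obtain ⟨m, p, c, b, h, rfl⟩ := hP C hC
    obtain ⟨m', p', c', b', h', hC'⟩ := hP C' hC'
    rw [← hC']
    rw [Sigma.mk.injEq] at heq
    obtain ⟨hd, hq⟩ := heq
    -- The equality of dimensions can be substituted only once the chosen simplices and dimensions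
    -- are free variables.
    generalize P (Finset.univ.image c) = Q at *
    generalize P C' = Q' at *
    generalize d (Finset.univ.image c) = e at *
    generalize d C' = e' at *
    subst hd
    exact h.image_eq_of_unimodularlyEquivalent h' (Quotient.exact (eq_of_heq hq))
  · rintro q ⟨e, Q, hQ, rfl⟩
    obtain ⟨m, p, c, b, h⟩ := isDivisorChainSimplex_iff.1 hQ
    have hC := image_mem_divisorChains h.seq
    obtain ⟨m', p', c', b', h', hcc'⟩ := hP _ hC
    exact ⟨_, hC, class_eq_of_image_eq h' h hcc'⟩

/-- Removing `v` from a chain leaves the empty set or a chain with a smaller largest element. -/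
theorem ncard_divisorChains_eq_sum {v : ℕ} (hv : 1 < v) :
    (divisorChains v).ncard =
      ∑ n ∈ v.divisors \ {v}, if n = 1 then 1 else (divisorChains n).ncard := by
  have hfin : ∀ n, (divisorChains n).Finite := fun n =>
    (n.divisors.powerset.finite_toSet).subset fun C hC => Finset.mem_coe.2 (Finset.mem_powerset.2 hC.1)
  -- The value at `n = 1` accounts for the chain `{v}`, which becomes empty without `v`; it matches
  -- the convention `M(1, k) = 1`.
  set F : ℕ → Finset (Finset ℕ) := fun n => if n = 1 then {∅} else (hfin n).toFinset with hF
  have hFcard : ∀ n, (F n).card = if n = 1 then 1 else (divisorChains n).ncard := fun n => by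
    simp only [hF]
    split_ifs
    · simp
    · rw [Set.ncard_eq_toFinset_card _ (hfin n)]
  have hFmem : ∀ n C, C ∈ F n ↔
      (C ⊆ n.divisors ∧ IsChain (· ∣ ·) (C : Set ℕ) ∧ 1 ∉ C) ∧ (n ≠ 1 → n ∈ C) := by
    intro n C
    simp only [hF]
    split_ifs with hn
    · subst hn
      rw [Finset.mem_singleton]
      constructor
      · rintro rfl
        simp
      · rintro ⟨⟨h1, -, h2⟩, -⟩
        rw [Finset.eq_empty_iff_forall_notMem]
        intro a ha
        have := h1 ha
        rw [Nat.divisors_one, Finset.mem_singleton] at this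
        exact h2 (this ▸ ha)
    · rw [Set.Finite.mem_toFinset, mem_divisorChains_iff]
      tauto
  have hcard : ((v.divisors \ {v}).sigma F).card =
      ∑ n ∈ v.divisors \ {v}, if n = 1 then 1 else (divisorChains n).ncard := by
    rw [Finset.card_sigma]
    exact Finset.sum_congr rfl fun n _ => hFcard n
  have hnmem : ∀ n, n ∈ v.divisors \ {v} ↔ n ∣ v ∧ n ≠ v := fun n => by
    rw [Finset.mem_sdiff, Finset.mem_singleton, Nat.mem_divisors]
    constructor
    · exact fun h => ⟨h.1.1, h.2⟩
    · exact fun h => ⟨⟨h.1, by omega⟩, h.2⟩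
  have hnot : ∀ n C, n ∈ v.divisors \ {v} → C ∈ F n → v ∉ C := fun n C hn hC hvC => by
    obtain ⟨hnv, hne⟩ := (hnmem n).1 hn
    exact hne (Nat.dvd_antisymm hnv (Nat.dvd_of_mem_divisors (((hFmem n C).1 hC).1.1 hvC)))
  rw [← hcard, ← Set.ncard_coe_finset]
  symm
  refine Set.ncard_congr (fun u _ => insert v u.2) ?_ ?_ ?_
  · rintro ⟨n, C⟩ hu
    obtain ⟨hn, hC⟩ := Finset.mem_sigma.1 (Finset.mem_coe.1 hu)
    dsimp only at hn hC ⊢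
    obtain ⟨⟨h1, h2, h3⟩, h4⟩ := (hFmem n C).1 hC
    obtain ⟨hnv, hne⟩ := (hnmem n).1 hn
    have hdvd : ∀ a ∈ C, a ∣ v := fun a ha => (Nat.dvd_of_mem_divisors (h1 ha)).trans hnv
    rw [mem_divisorChains_iff]
    refine ⟨fun a ha => ?_, ?_, Finset.mem_insert_self _ _, ?_⟩
    · rw [Nat.mem_divisors]
      refine ⟨?_, by omega⟩
      rcases Finset.mem_insert.1 ha with rfl | ha
      · exact dvd_rfl
      · exact hdvd a ha
    · rw [Finset.coe_insert]
      exact h2.insert fun a ha _ => Or.inr (hdvd a ha)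
    · rw [Finset.mem_insert, not_or]
      exact ⟨by omega, h3⟩
  · rintro ⟨n, C⟩ ⟨n', C'⟩ hu hu' heq
    obtain ⟨hn, hC⟩ := Finset.mem_sigma.1 (Finset.mem_coe.1 hu)
    obtain ⟨hn', hC'⟩ := Finset.mem_sigma.1 (Finset.mem_coe.1 hu')
    dsimp only at hn hC hn' hC' heq
    obtain rfl : C = C' := by
      rw [← Finset.erase_insert (hnot n C hn hC), heq, Finset.erase_insert (hnot n' C' hn' hC')]
    obtain ⟨⟨h1, -, h3⟩, h4⟩ := (hFmem n C).1 hC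
    obtain ⟨⟨h1', -, h3'⟩, h4'⟩ := (hFmem n' C).1 hC'
    -- The set `C` determines its index `n`, since two possible indices divide each other.
    have hone : ∀ {l l' : ℕ}, C ⊆ l.divisors → (l' ≠ 1 → l' ∈ C) → l' ∣ l := by
      intro l l' hl hl'
      by_cases h : l' = 1
      · rw [h]
        exact one_dvd _
      · exact Nat.dvd_of_mem_divisors (hl (hl' h))
    obtain rfl : n = n' := Nat.dvd_antisymm (hone h1' h4) (hone h1 h4')
    rfl
  · intro C hC
    rw [mem_divisorChains_iff] at hC
    obtain ⟨h1, h2, h3, h4⟩ := hC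
    have h0 : ∀ a ∈ C, 0 < a := fun a ha => Nat.pos_of_mem_divisors (h1 ha)
    have hchain : IsChain (· ∣ ·) ((C.erase v : Finset ℕ) : Set ℕ) :=
      h2.mono (Finset.coe_subset.2 (Finset.erase_subset v C))
    have h4' : 1 ∉ C.erase v := fun h => h4 (Finset.mem_of_mem_erase h)
    rcases (C.erase v).eq_empty_or_nonempty with he | hne
    · refine ⟨⟨1, C.erase v⟩, Finset.mem_coe.2 (Finset.mem_sigma.2 ⟨?_, ?_⟩),
        Finset.insert_erase h3⟩
      · exact (hnmem 1).2 ⟨one_dvd _, by omega⟩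
      · exact (hFmem _ _).2 ⟨⟨by simp [he], hchain, h4'⟩, fun h => absurd rfl h⟩
    · have hmem := (C.erase v).max'_mem hne
      set n := (C.erase v).max' hne with hn
      have hnC := Finset.mem_of_mem_erase hmem
      refine ⟨⟨n, C.erase v⟩, Finset.mem_coe.2 (Finset.mem_sigma.2 ⟨?_, ?_⟩),
        Finset.insert_erase h3⟩
      · exact (hnmem n).2 ⟨Nat.dvd_of_mem_divisors (h1 hnC), Finset.ne_of_mem_erase hmem⟩
      · refine (hFmem _ _).2 ⟨⟨fun a ha => ?_, hchain, h4'⟩, fun _ => hmem⟩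
        rw [Nat.mem_divisors]
        exact ⟨dvd_of_isChain_of_le h2 h0 (Finset.mem_of_mem_erase ha) hnC
          ((C.erase v).le_max' a ha), (h0 n hnC).ne'⟩

theorem corollary4p3 (v k : ℕ) (hv : 1 < v) :
    numDivisorChainSimplices v k = (divisorChains v).ncard ∧
      numDivisorChainSimplices v k =
        ∑ n ∈ v.divisors \ {v}, numDivisorChainSimplices n k := by
  have h : ∀ n, numDivisorChainSimplices n k =
      if n = 1 then 1 else (divisorChains n).ncard := fun n => by
    rw [numDivisorChainSimplices, ncard_divisorChainClasses]
  simp_rw [h]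
  rw [if_neg hv.ne']
  exact ⟨rfl, ncard_divisorChains_eq_sum hv⟩
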